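/- Conventions. $2^{<\mathbb N}$ is the set of finite binary strings and $2^{\mathbb N}$ is Cantor space with the uniform measure $\lambda$. A $\Pi^0_1$ class is the complement of $\bigcup_{\sigma\in S}\{X\in 2^{\mathbb N}:\sigma\prec X\}$ for a c.e. set $S\subseteq 2^{<\mathbb N}$; the empty class is allowed. A Turing functional is a c.e. set $\Phi$ of pairs of strings such that $\tau,\tau'$ are comparable under the prefix relation whenever $(\sigma,\tau),(\sigma',\tau')\in\Phi$ and $\sigma\preceq\sigma'$; $\Phi^X$ is the (finite or infinite) sequence determined by the strings $\tau$ with $(\sigma,\tau)\in\Phi$ for some $\sigma\prec X$; $X\in\mathrm{dom}(\Phi)$ if $\Phi^X$ is infinite, and then $\Phi(X)=\Phi^X$. Let $(\Phi_e)_{e\in\mathbb N}$ be an effective enumeration of all Turing functionals, let $\widehat\Phi$ be the universal functional given by $\widehat\Phi(1^e0X)=\Phi_e(X)$, and let $$\mathbf M(\sigma)=\lambda\{X:\widehat\Phi^X\succeq\sigma\},$$ which is a universal lower semi-computable continuous semi-measure. For a $\Pi^0_1$ class $\mathcal C$ let $T$ be its canonical co-c.e. tree, i.e. the set of all finite prefixes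 of members of $\mathcal C$, and let $T_n$ be the set of strings of length $n$ in $T$. The class $\mathcal C$ is *deep* if there is a computable, non-decreasing, unbounded $h:\mathbb N\to\mathbb N$ such that $$\mathbf M(T_n):=\sum_{\sigma\in T_n}\mathbf M(\sigma)\le 2^{-h(n)}\quad\text{for all } n.$$ For $\Pi^0_1$ classes $\mathcal C,\mathcal D$, write $\mathcal C\le_s\mathcal D$ (Medvedev reducibility) if there is one Turing functional $\Phi$ with $\mathcal D\subseteq\mathrm{dom}(\Phi)$ and $\Phi(\mathcal D)\subseteq\mathcal C$. Let $\mathcal E_s$ be the set of equivalence classes of $\Pi^0_1$ classes under ($\mathcal C\le_s\mathcal D$ and $\mathcal D\le_s\mathcal C$), ordered by $\le_s$; it is a lattice, with greatest lower bounds induced by $\inf(\mathcal C,\mathcal D)=\{0^\frown X:X\in\mathcal C\}\cup\{1^\frown Y:Y\in\mathcal D\}$ and least upper bounds induced by $\sup(\mathcal C,\mathcal D)=\{X\oplus Y:X\in\mathcal C,\ Y\in\mathcal D\}$. A *filter* in a lattice is a subset $F$ such that $x\in F$ and $x\le y$ imply $y\in F$, and $x,y\in F$ implies $\inf(x,y)\in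 F$. **Theorem.** The collection of deep $\Pi^0_1$ classes forms a filter in $\mathcal E_s$. That is, for all $\Pi^0_1$ classes $\mathcal C,\mathcal D$: (i) if $\mathcal C$ is deep and $\mathcal C\le_s\mathcal D$, then $\mathcal D$ is deep (in particular, depth is invariant under Medvedev equivalence); (ii) if $\mathcal C$ and $\mathcal D$ are deep, then $\inf(\mathcal C,\mathcal D)$ is deep; and the set of Medvedev degrees of deep $\Pi^0_1$ classes is a filter in the lattice $\mathcal E_s$. -/

import Mathlib

/-!  Deep effectively closed classes and the lattice of Medvedev degrees. -/

open scoped ENNReal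

namespace DeepClasses

/-! ### Strings, sequences, computably enumerable sets -/

/-- Finite binary strings; `σ <+: τ` says that `σ` is a prefix of `τ`. -/
abbrev Str : Type := List Bool

/-- Cantor space: infinite binary sequences. -/
abbrev Cantor : Type := ℕ → Bool

/-- The string formed by the first `n` bits of `X`. -/
def restr (X : Cantor) (n : ℕ) : Str := (List.range n).map X

/-- The finite string `σ` is a prefix of the infinite sequence `X`. -/
def PrefixOf (σ : Str) (X : Cantor) : Prop := restr X σ.length = σ

/-- Two strings are comparable if one of them is a prefix of the other. -/
def Comparable (σ τ : Str) : Prop := σ <+: τ ∨ τ <+: σ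

instance (σ τ : Str) : Decidable (Comparable σ τ) := by
  unfold Comparable; infer_instance

/-- The open set of all sequences with a prefix in `S`. -/
def openOf (S : Set Str) : Set Cantor := {X | ∃ σ ∈ S, PrefixOf σ X}

/-- `C` is a `Π⁰₁` class: the complement of the open set generated by a c.e. set of strings. -/
def IsPi01 (C : Set Cantor) : Prop :=
  ∃ S : Set Str, REPred (fun σ => σ ∈ S) ∧ C = (openOf S)ᶜ

/-- The canonical co-c.e. tree of `C`: all prefixes of members of `C`. -/
def canonicalTree (C : Set Cantor) : Set Str := {σ | ∃ X ∈ C, PrefixOf σ X}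

/-- The `n`-th level of a tree. -/
def level (T : Set Str) (n : ℕ) : Set Str := {σ ∈ T | σ.length = n}

/-! ### Turing functionals -/

/-- Consistency of a set of pairs of strings. -/
def Consistent (Φ : Set (Str × Str)) : Prop :=
  ∀ σ τ σ' τ' : Str, (σ, τ) ∈ Φ → (σ', τ') ∈ Φ → σ <+: σ' → Comparable τ τ'

/-- A Turing functional is a consistent c.e. set of pairs of strings. -/
def IsTuringFunctional (Φ : Set (Str × Str)) : Prop :=
  REPred (fun p => p ∈ Φ) ∧ Consistent Φ

/-- `τ` is a prefix of the (finite or infinite) output `Φ^X`. The empty string always is. -/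
def Outputs (Φ : Set (Str × Str)) (X : Cantor) (τ : Str) : Prop :=
  τ = [] ∨ ∃ σ τ' : Str, (σ, τ') ∈ Φ ∧ PrefixOf σ X ∧ τ <+: τ'

/-- `X ∈ dom Φ` and `Φ(X) = Y`: every initial segment of `Y` is a prefix of `Φ^X`. -/
def MapsTo (Φ : Set (Str × Str)) (X Y : Cantor) : Prop := ∀ n : ℕ, Outputs Φ X (restr Y n)

/-! ### A universal Turing functional and a priori probability -/

/-- The pair of strings (if any) which the `e`-th partial computable function puts at stage `s`
into the c.e. set of pairs given by its domain. Every element of this c.e. set appears at some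
stage. -/
def candidate (e s : ℕ) : Option (Str × Str) :=
  (Nat.Partrec.Code.evaln s.unpair.2 (Denumerable.ofNat Nat.Partrec.Code e) s.unpair.1).bind
    fun _ => Encodable.decode s.unpair.1

/-- The finite list of pairs accepted before stage `s`: a new pair is accepted only
if it keeps the list consistent. -/
def accepted (e : ℕ) : ℕ → List (Str × Str)
  | 0 => []
  | s + 1 =>
    match candidate e s with
    | none => accepted e s
    | some p =>
      if ∀ q ∈ accepted e s, Comparable p.1 q.1 → Comparable p.2 q.2 then p :: accepted e s
      else accepted e s

/-- The `e`-th Turing functional `Φ_e`. This is an effective list of all Turing functionals: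
a consistent c.e. set of pairs is not changed by the acceptance procedure. -/
def functional (e : ℕ) : Set (Str × Str) := {p | ∃ s, p ∈ accepted e s}

/-- The universal Turing functional, `Φ(1^e 0 X) = Φ_e(X)`. -/
def universalFunctional : Set (Str × Str) :=
  {p | ∃ (e : ℕ) (σ : Str), (σ, p.2) ∈ functional e ∧
    p.1 = List.replicate e true ++ false :: σ}

/-- The uniform measure on Cantor space (independent tosses of a fair coin). -/
noncomputable def fairCoin : MeasureTheory.Measure Cantor :=
  MeasureTheory.Measure.infinitePi fun _ : ℕ => (PMF.uniformOfFintype Bool).toMeasure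

/-- The semi-measure induced by a Turing functional: the probability that `Φ^X` extends `σ`. -/
noncomputable def inducedSemimeasure (Φ : Set (Str × Str)) (σ : Str) : ℝ≥0∞ :=
  fairCoin {X | Outputs Φ X σ}

/-- A priori probability `M`: the universal lower semi-computable continuous semi-measure induced
by the universal Turing functional. -/
noncomputable def aprioriM (σ : Str) : ℝ≥0∞ := inducedSemimeasure universalFunctional σ

/-! ### Depth -/

/-- A computable order: a computable, non-decreasing and unbounded function. -/
def IsComputableOrder (h : ℕ → ℕ) : Prop :=
  Computable h ∧ Monotone h ∧ ∀ k, ∃ n, k ≤ h n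

/-- `C` is deep: for some computable order `h`, the a priori probability of the `n`-th level of the
canonical co-c.e. tree of `C` is at most `2 ^ (-h n)`, for all `n`. (The inequality is not strict,
because at `n = 0` the left side is `1` unless `C` is empty.) -/
def IsDeep (C : Set Cantor) : Prop :=
  ∃ h : ℕ → ℕ, IsComputableOrder h ∧
    ∀ n : ℕ, ∑' σ : level (canonicalTree C) n, aprioriM σ ≤ (2⁻¹ : ℝ≥0∞) ^ h n

/-! ### Operations on sequences and classes -/

/-- The sequence `b ⌢ X`. -/
def consSeq (b : Bool) (X : Cantor) : Cantor
  | 0 => b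
  | n + 1 => X n

/-- The sequence `X ⊕ Y`. -/
def joinSeq (X Y : Cantor) : Cantor := fun n => if n % 2 = 0 then X (n / 2) else Y (n / 2)

/-- `inf(C, D) = {0 ⌢ X | X ∈ C} ∪ {1 ⌢ Y | Y ∈ D}`. -/
def infClass (C D : Set Cantor) : Set Cantor := consSeq false '' C ∪ consSeq true '' D

/-- `sup(C, D) = {X ⊕ Y | X ∈ C, Y ∈ D}`. -/
def supClass (C D : Set Cantor) : Set Cantor := Set.image2 joinSeq C D

/-- `C ≤ₛ D`: one Turing functional is defined on all of `D` and maps `D` into `C`. -/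
def MedvedevLE (C D : Set Cantor) : Prop :=
  ∃ Φ : Set (Str × Str), IsTuringFunctional Φ ∧ ∀ X ∈ D, ∃ Y ∈ C, MapsTo Φ X Y

/-! ### Closure properties of c.e. predicates -/

section RE

variable {α β : Type} [Primcodable α] [Primcodable β]

theorem re_comp {p : β → Prop} (hp : REPred p) {f : α → β} (hf : Computable f) :
    REPred fun a => p (f a) :=
  Partrec.comp hp hf

theorem re_normal {p : α → Prop} (hp : REPred p) :
    ∃ f : α → ℕ → Bool, Computable₂ f ∧ ∀ a, p a ↔ ∃ n, f a n = true := by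
  obtain ⟨c, hc⟩ := Nat.Partrec.Code.exists_code.1 hp
  refine ⟨fun a n => (Nat.Partrec.Code.evaln n c (Encodable.encode a)).isSome, ?_, ?_⟩
  · change Computable fun x : α × ℕ =>
      (Nat.Partrec.Code.evaln x.2 c (Encodable.encode x.1)).isSome
    refine (Primrec.option_isSome.to_comp).comp ?_
    exact Nat.Partrec.Code.primrec_evaln.to_comp.comp
      ((Computable.snd.pair (Computable.const c)).pair (Computable.encode.comp Computable.fst))
  · intro a
    have h1 : p a ↔ (c.eval (Encodable.encode a)).Dom := by
      rw [hc]; simp [Part.assert]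
    rw [h1, Part.dom_iff_mem]
    simp only [Nat.Partrec.Code.evaln_complete, Option.isSome_iff_exists, Option.mem_def]
    exact exists_comm

theorem re_of_normal {f : α → ℕ → Bool} (hf : Computable₂ f) :
    REPred fun a => ∃ n, f a n = true := by
  have h : Partrec fun a => Nat.rfind fun n => (Part.some (f a n) : Part Bool) :=
    Partrec.rfind (Computable₂.partrec₂ hf)
  refine (h.dom_re).of_eq fun a => ?_
  rw [Part.dom_iff_mem]
  constructor
  · rintro ⟨n, hn⟩
    exact ⟨n, by simpa using (Nat.mem_rfind.1 hn).1⟩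
  · rintro ⟨n, hn⟩
    have : (Nat.rfind fun n => (Part.some (f a n) : Part Bool)).Dom :=
      Nat.rfind_dom.2 ⟨n, by simp [hn], fun _ => trivial⟩
    exact Part.dom_iff_mem.1 this

theorem re_and {p q : α → Prop} (hp : REPred p) (hq : REPred q) :
    REPred fun a => p a ∧ q a := by
  have h : Partrec fun a => (Part.assert (p a) fun _ => Part.some ()).bind
      fun _ => Part.assert (q a) fun _ => Part.some () :=
    Partrec.bind hp (Partrec.comp hq Computable.fst)
  refine (h.dom_re).of_eq fun a => ?_
  simp [Part.assert]

theorem re_or {p q : α → Prop} (hp : REPred p) (hq : REPred q) :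
    REPred fun a => p a ∨ q a := by
  obtain ⟨f, hf, hfp⟩ := re_normal hp
  obtain ⟨g, hg, hgq⟩ := re_normal hq
  refine (re_of_normal (f := fun a n => f a n || g a n)
    (Computable.to₂ (Primrec.or.to_comp.comp hf hg))).of_eq fun a => ?_
  simp only [hfp, hgq, Bool.or_eq_true, exists_or]

theorem re_exists {p : α → β → Prop} (hp : REPred fun x : α × β => p x.1 x.2) :
    REPred fun a => ∃ b, p a b := by
  obtain ⟨f, hf, hfp⟩ := re_normal hp
  have hg : Computable₂ fun (a : α) (n : ℕ) =>
      ((Encodable.decode n.unpair.1 : Option β).map fun b => f (a, b) n.unpair.2).getD false := by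
    change Computable fun x : α × ℕ =>
      ((Encodable.decode x.2.unpair.1 : Option β).map
        fun b => f (x.1, b) x.2.unpair.2).getD false
    refine Computable.option_getD ?_ (Computable.const false)
    refine Computable.option_map ?_ ?_
    · exact Computable.decode.comp (Computable.fst.comp (Computable.unpair.comp Computable.snd))
    · change Computable fun y : (α × ℕ) × β => f (y.1.1, y.2) y.1.2.unpair.2
      refine hf.comp ((Computable.fst.comp Computable.fst).pair Computable.snd) ?_
      exact Computable.snd.comp (Computable.unpair.comp (Computable.snd.comp Computable.fst))
  refine (re_of_normal hg).of_eq fun a => ?_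
  constructor
  · rintro ⟨n, hn⟩
    rcases hd : (Encodable.decode n.unpair.1 : Option β) with _ | b
    · simp [hd] at hn
    · simp only [hd, Option.map_some, Option.getD_some] at hn
      exact ⟨b, (hfp (a, b)).2 ⟨_, hn⟩⟩
  · rintro ⟨b, hb⟩
    obtain ⟨n, hn⟩ := (hfp (a, b)).1 hb
    exact ⟨Nat.pair (Encodable.encode b) n, by simp [hn]⟩

theorem re_of_primrec {p : α → Prop} (hp : PrimrecPred p) : REPred p := by
  obtain ⟨_, h⟩ := hp
  exact ComputablePred.to_re ⟨_, h.to_comp⟩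

end RE

/-! ### Elementary facts about strings -/

theorem length_restr (X : Cantor) (n : ℕ) : (restr X n).length = n := by simp [restr]

theorem prefixOf_iff {σ : Str} {X : Cantor} :
    PrefixOf σ X ↔ ∀ i (h : i < σ.length), σ[i] = X i := by
  constructor
  · intro h i hi
    have h2 : σ[i]? = (restr X σ.length)[i]? := by rw [show restr X σ.length = σ from h]
    simpa [restr, hi] using h2
  · intro h
    refine List.ext_getElem (length_restr _ _) fun i h1 h2 => ?_
    simp [restr, h i h2]

theorem prefixOf_restr (X : Cantor) (n : ℕ) : PrefixOf (restr X n) X := by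
  simp [PrefixOf, length_restr]

theorem restr_prefix (X : Cantor) {n m : ℕ} (h : n ≤ m) : restr X n <+: restr X m := by
  unfold restr
  have h1 : List.range n <+: List.range m := by
    rw [List.prefix_iff_eq_take, List.length_range, List.take_range, min_eq_left h]
  exact h1.map X

theorem Comparable.symm {σ τ : Str} (h : Comparable σ τ) : Comparable τ σ := Or.symm h

theorem Comparable.of_prefix {σ τ σ' τ' : Str} (h : Comparable σ' τ') (h1 : σ <+: σ')
    (h2 : τ <+: τ') : Comparable σ τ := by
  rcases h with h | h
  · exact List.prefix_or_prefix_of_prefix (h1.trans h) h2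
  · exact List.prefix_or_prefix_of_prefix h1 (h2.trans h)

theorem Consistent.comparable {Φ : Set (Str × Str)} (h : Consistent Φ) {σ τ σ' τ' : Str}
    (h1 : (σ, τ) ∈ Φ) (h2 : (σ', τ') ∈ Φ) (hc : Comparable σ σ') : Comparable τ τ' := by
  rcases hc with hc | hc
  · exact h _ _ _ _ h1 h2 hc
  · exact (h _ _ _ _ h2 h1 hc).symm

theorem prefix_of_getElem {σ τ : Str} (hl : σ.length ≤ τ.length)
    (h : ∀ i (h1 : i < σ.length), σ[i] = τ[i]) : σ <+: τ := by
  rw [List.prefix_iff_eq_take]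
  refine List.ext_getElem (by simp [hl]) fun i h1 h2 => ?_
  simp [h i h1]

theorem comparable_iff {σ τ : Str} :
    Comparable σ τ ↔ ∀ i (h1 : i < σ.length) (h2 : i < τ.length), σ[i] = τ[i] := by
  constructor
  · rintro (h | h) i h1 h2
    · exact h.getElem h1
    · exact (h.getElem h2).symm
  · intro h
    rcases le_total σ.length τ.length with hl | hl
    · exact Or.inl (prefix_of_getElem hl fun i h1 => h i h1 (h1.trans_le hl))
    · exact Or.inr (prefix_of_getElem hl fun i h1 => (h i (h1.trans_le hl) h1).symm)

theorem primrec_prefix {α : Type} [Primcodable α] {f g : α → Str} (hf : Primrec f)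
    (hg : Primrec g) : PrimrecPred fun a => f a <+: g a := by
  have : PrimrecPred fun a => f a = (g a).take (f a).length :=
    Primrec.eq.comp hf (Primrec.list_take.comp (Primrec.list_length.comp hf) hg)
  exact this.of_eq fun a => List.prefix_iff_eq_take.symm

/-! ### The Turing functionals behind the lattice of Medvedev degrees -/

theorem identity_functional : IsTuringFunctional {p | p.2 = p.1} := by
  refine ⟨re_of_primrec (Primrec.eq.comp Primrec.snd Primrec.fst), ?_⟩
  intro σ τ σ' τ' h1 h2 h
  simp only [Set.mem_ofPred_eq] at h1 h2
  subst h1 h2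
  exact Or.inl h

theorem medvedevLE_refl (C : Set Cantor) : MedvedevLE C C :=
  ⟨_, identity_functional, fun X hX => ⟨X, hX, fun n =>
    Or.inr ⟨restr X n, restr X n, rfl, prefixOf_restr X n, List.prefix_refl _⟩⟩⟩

theorem medvedevLE_of_subset {C D : Set Cantor} (h : D ⊆ C) : MedvedevLE C D :=
  let ⟨Φ, hΦ, hm⟩ := medvedevLE_refl D
  ⟨Φ, hΦ, fun X hX => let ⟨Y, hY, hXY⟩ := hm X hX; ⟨Y, h hY, hXY⟩⟩

theorem medvedevLE_trans {C D E : Set Cantor} (h1 : MedvedevLE C D) (h2 : MedvedevLE D E) :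
    MedvedevLE C E := by
  obtain ⟨Ψ, ⟨hΨ, cΨ⟩, mΨ⟩ := h1
  obtain ⟨Φ, ⟨hΦ, cΦ⟩, mΦ⟩ := h2
  refine ⟨{p | ∃ τ' : Str, (τ', p.2) ∈ Ψ ∧ (τ' = [] ∨ ∃ τ : Str, (p.1, τ) ∈ Φ ∧ τ' <+: τ)},
    ⟨?_, ?_⟩, ?_⟩
  · refine re_exists (p := fun (p : Str × Str) (τ' : Str) =>
      (τ', p.2) ∈ Ψ ∧ (τ' = [] ∨ ∃ τ : Str, (p.1, τ) ∈ Φ ∧ τ' <+: τ)) ?_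
    refine re_and (re_comp hΨ (f := fun x : (Str × Str) × Str => (x.2, x.1.2)) ?_) (re_or ?_ ?_)
    · exact Computable.snd.pair (Computable.snd.comp Computable.fst)
    · exact re_of_primrec (Primrec.eq.comp Primrec.snd (Primrec.const []))
    · refine re_exists (p := fun (x : (Str × Str) × Str) (τ : Str) =>
        (x.1.1, τ) ∈ Φ ∧ x.2 <+: τ) ?_
      refine re_and (re_comp hΦ
        (f := fun y : ((Str × Str) × Str) × Str => (y.1.1.1, y.2)) ?_) (re_of_primrec ?_)
      · exact (Computable.fst.comp (Computable.fst.comp Computable.fst)).pair Computable.snd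
      · exact primrec_prefix (Primrec.snd.comp Primrec.fst) Primrec.snd
  · rintro σ υ σ' υ' ⟨τ₁, h1, h1'⟩ ⟨τ₂, h2, h2'⟩ hσ
    refine cΨ.comparable h1 h2 ?_
    rcases h1' with rfl | ⟨τ, hτ, hp⟩
    · exact Or.inl List.nil_prefix
    rcases h2' with rfl | ⟨τ', hτ', hp'⟩
    · exact Or.inr List.nil_prefix
    exact (cΦ _ _ _ _ hτ hτ' hσ).of_prefix hp hp'
  · intro X hX
    obtain ⟨Y, hY, hXY⟩ := mΦ X hX
    obtain ⟨Z, hZ, hYZ⟩ := mΨ Y hY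
    refine ⟨Z, hZ, fun n => ?_⟩
    rcases hYZ n with h | ⟨σ, τ, hm, hp, ht⟩
    · exact Or.inl h
    refine Or.inr ?_
    have hout := hXY σ.length
    rw [show restr Y σ.length = σ from hp] at hout
    rcases hout with rfl | ⟨σ', τ', hm', hp', ht'⟩
    · exact ⟨[], τ, ⟨[], hm, Or.inl rfl⟩, rfl, ht⟩
    · exact ⟨σ', τ, ⟨σ, hm, Or.inr ⟨τ', hm', ht'⟩⟩, hp', ht⟩

theorem restr_consSeq (b : Bool) (X : Cantor) (n : ℕ) :
    restr (consSeq b X) (n + 1) = b :: restr X n := by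
  simp [restr, List.range_succ_eq_map, consSeq, Function.comp_def]

theorem prefixOf_cons {b : Bool} {σ : Str} {X : Cantor} :
    PrefixOf (b :: σ) (consSeq b X) ↔ PrefixOf σ X := by
  simp [PrefixOf, restr_consSeq]

theorem consSeq_eta (X : Cantor) : consSeq (X 0) (fun n => X (n + 1)) = X := by
  funext n; cases n <;> rfl

theorem medvedevLE_cons (b : Bool) {C D : Set Cantor} (h : consSeq b '' D ⊆ C) :
    MedvedevLE C D := by
  refine ⟨{p | p.2 = b :: p.1}, ⟨re_of_primrec (Primrec.eq.comp Primrec.snd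
    (Primrec.list_cons.comp (Primrec.const b) Primrec.fst)), ?_⟩, ?_⟩
  · rintro σ τ σ' τ' h1 h2 hσ
    simp only [Set.mem_ofPred_eq] at h1 h2
    subst h1 h2
    exact Or.inl (List.cons_prefix_cons.2 ⟨rfl, hσ⟩)
  · refine fun X hX => ⟨consSeq b X, h ⟨X, hX, rfl⟩, fun n => ?_⟩
    cases n with
    | zero => exact Or.inl rfl
    | succ n =>
      refine Or.inr ⟨restr X n, b :: restr X n, rfl, prefixOf_restr X n, ?_⟩
      rw [restr_consSeq]

theorem primrec_head_tail {p q : Str × Str → Prop} (hp : REPred p) (hq : REPred q) :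
    REPred fun x : Str × Str => (x.1.head? = some false ∧ p (x.1.tail, x.2)) ∨
      (x.1.head? = some true ∧ q (x.1.tail, x.2)) := by
  have ht : Computable fun x : Str × Str => (x.1.tail, x.2) :=
    ((Primrec.list_tail.comp Primrec.fst).pair Primrec.snd).to_comp
  have hh (b : Bool) : REPred fun x : Str × Str => x.1.head? = some b :=
    re_of_primrec (Primrec.eq.comp (Primrec.list_head?.comp Primrec.fst) (Primrec.const (some b)))
  exact re_or (re_and (hh false) (re_comp hp ht)) (re_and (hh true) (re_comp hq ht))

theorem le_infClass {C D E : Set Cantor} (h1 : MedvedevLE E C) (h2 : MedvedevLE E D) :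
    MedvedevLE E (infClass C D) := by
  obtain ⟨Φ, ⟨hΦ, cΦ⟩, mΦ⟩ := h1
  obtain ⟨Ψ, ⟨hΨ, cΨ⟩, mΨ⟩ := h2
  refine ⟨{x | (x.1.head? = some false ∧ (x.1.tail, x.2) ∈ Φ) ∨
      (x.1.head? = some true ∧ (x.1.tail, x.2) ∈ Ψ)}, ⟨primrec_head_tail hΦ hΨ, ?_⟩, ?_⟩
  · rintro σ τ σ' τ' hσ hσ' hp
    rcases σ with _ | ⟨b, σ⟩
    · simp at hσ
    rcases σ' with _ | ⟨b', σ'⟩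
    · simp at hσ'
    obtain ⟨rfl, hp'⟩ := List.cons_prefix_cons.1 hp
    cases b
    · simp only [Set.mem_ofPred_eq, List.head?_cons, List.tail_cons, true_and, Option.some.injEq,
        Bool.false_eq_true, false_and, or_false] at hσ hσ'
      exact cΦ _ _ _ _ hσ hσ' hp'
    · simp only [Set.mem_ofPred_eq, List.head?_cons, List.tail_cons, true_and, Option.some.injEq,
        Bool.true_eq_false, false_and, false_or] at hσ hσ'
      exact cΨ _ _ _ _ hσ hσ' hp'
  · rintro _ (⟨X, hX, rfl⟩ | ⟨X, hX, rfl⟩)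
    · obtain ⟨Y, hY, hXY⟩ := mΦ X hX
      refine ⟨Y, hY, fun n => (hXY n).imp id ?_⟩
      rintro ⟨σ, τ, hm, hp, ht⟩
      exact ⟨false :: σ, τ, Or.inl ⟨rfl, hm⟩, prefixOf_cons.2 hp, ht⟩
    · obtain ⟨Y, hY, hXY⟩ := mΨ X hX
      refine ⟨Y, hY, fun n => (hXY n).imp id ?_⟩
      rintro ⟨σ, τ, hm, hp, ht⟩
      exact ⟨true :: σ, τ, Or.inr ⟨rfl, hm⟩, prefixOf_cons.2 hp, ht⟩

theorem isPi01_infClass {C D : Set Cantor} (hC : IsPi01 C) (hD : IsPi01 D) :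
    IsPi01 (infClass C D) := by
  obtain ⟨S, hS, rfl⟩ := hC
  obtain ⟨T, hT, rfl⟩ := hD
  refine ⟨{σ | (σ.head? = some false ∧ σ.tail ∈ S) ∨ (σ.head? = some true ∧ σ.tail ∈ T)}, ?_, ?_⟩
  · exact re_comp (primrec_head_tail (p := fun x => x.1 ∈ S) (q := fun x => x.1 ∈ T)
      (re_comp hS Computable.fst) (re_comp hT Computable.fst))
      (f := fun σ : Str => (σ, ([] : Str))) (Computable.id.pair (Computable.const []))
  · ext X
    obtain ⟨b, X, rfl⟩ : ∃ b Y, consSeq b Y = X := ⟨_, _, consSeq_eta X⟩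
    have inj : ∀ {b b' : Bool} {X Y : Cantor}, consSeq b X = consSeq b' Y → b = b' ∧ X = Y :=
      fun h => ⟨congrFun h 0, funext fun n => congrFun h (n + 1)⟩
    simp only [infClass, Set.mem_union, Set.mem_image, Set.mem_compl_iff, openOf,
      Set.mem_ofPred_eq, not_exists, not_and]
    constructor
    · rintro (⟨Y, hY, h⟩ | ⟨Y, hY, h⟩) σ hσ hp <;> obtain ⟨rfl, rfl⟩ := inj h <;>
        rcases σ with _ | ⟨b, σ⟩
      · simp at hσ
      · have hb : b = false := congrArg (fun l => l.headI) ((restr_consSeq _ _ _).symm.trans hp)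
          |>.symm
        subst hb
        exact hY σ (by simpa using hσ) (prefixOf_cons.1 hp)
      · simp at hσ
      · have hb : b = true := congrArg (fun l => l.headI) ((restr_consSeq _ _ _).symm.trans hp)
          |>.symm
        subst hb
        exact hY σ (by simpa using hσ) (prefixOf_cons.1 hp)
    · intro h
      cases b
      · exact Or.inl ⟨X, fun σ hσ hp => h (false :: σ) (by simpa using hσ)
          (prefixOf_cons.2 hp), rfl⟩
      · exact Or.inr ⟨X, fun σ hσ hp => h (true :: σ) (by simpa using hσ)
          (prefixOf_cons.2 hp), rfl⟩

/-- The bits of `σ` at the positions `b, b + 2, b + 4, …`. -/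
def half (b : ℕ) (σ : Str) : Str :=
  (List.range ((σ.length + 1 - b) / 2)).map fun i => σ.getD (2 * i + b) false

theorem primrec_half (b : ℕ) : Primrec (half b) := by
  unfold half
  refine Primrec.list_map ?_ ?_
  · refine Primrec.list_range.comp (Primrec.nat_div.comp ?_ (Primrec.const 2))
    exact Primrec.nat_sub.comp (Primrec.succ.comp Primrec.list_length) (Primrec.const b)
  · refine (Primrec.list_getD false).comp Primrec.fst ?_
    exact Primrec.nat_add.comp (Primrec.nat_mul.comp (Primrec.const 2) Primrec.snd)
      (Primrec.const b)

theorem half_restr (b : ℕ) (X : Cantor) (n : ℕ) :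
    half b (restr X n) = restr (fun i => X (2 * i + b)) ((n + 1 - b) / 2) := by
  refine List.ext_getElem (by simp [half, restr]) fun i h1 h2 => ?_
  have h3 : i < (n + 1 - b) / 2 := by simpa [restr] using h2
  have h4 : 2 * i + b < n := by omega
  simp [half, restr, h4]

theorem half_prefix (b : ℕ) {σ τ : Str} (h : σ <+: τ) : half b σ <+: half b τ := by
  have hl := h.length_le
  refine prefix_of_getElem ?_ fun i h1 => ?_
  · simp only [half, List.length_map, List.length_range]; omega
  · have h3 : i < (σ.length + 1 - b) / 2 := by simpa [half] using h1
    have h4 : 2 * i + b < σ.length := by omega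
    have h5 : 2 * i + b < τ.length := by omega
    simp [half, h4, h5, h.getElem h4]

theorem medvedevLE_half (b : ℕ) {C D : Set Cantor}
    (h : ∀ X ∈ D, (fun i => X (2 * i + b)) ∈ C) : MedvedevLE C D := by
  refine ⟨{p | p.2 = half b p.1}, ⟨re_of_primrec (Primrec.eq.comp Primrec.snd
    ((primrec_half b).comp Primrec.fst)), ?_⟩, ?_⟩
  · rintro σ τ σ' τ' h1 h2 hσ
    simp only [Set.mem_ofPred_eq] at h1 h2
    subst h1 h2
    exact Or.inl (half_prefix b hσ)
  · refine fun X hX => ⟨_, h X hX, fun n => ?_⟩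
    refine Or.inr ⟨restr X (2 * n + b), half b (restr X (2 * n + b)), rfl, prefixOf_restr X _, ?_⟩
    rw [half_restr]
    exact restr_prefix _ (by omega)

theorem joinSeq_even (X Y : Cantor) : (fun i => joinSeq X Y (2 * i + 0)) = X := by
  funext i; simp [joinSeq]

theorem joinSeq_odd (X Y : Cantor) : (fun i => joinSeq X Y (2 * i + 1)) = Y := by
  funext i
  have h1 : (2 * i + 1) % 2 = 1 := by omega
  have h2 : (2 * i + 1) / 2 = i := by omega
  simp [joinSeq, h1, h2]

theorem joinSeq_eta (X : Cantor) :
    joinSeq (fun i => X (2 * i + 0)) (fun i => X (2 * i + 1)) = X := by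
  funext n
  simp only [joinSeq]
  split_ifs with h <;> congr 1 <;> omega

theorem mem_supClass {C D : Set Cantor} {X : Cantor} :
    X ∈ supClass C D ↔ (fun i => X (2 * i + 0)) ∈ C ∧ (fun i => X (2 * i + 1)) ∈ D := by
  constructor
  · rintro ⟨Y, hY, Z, hZ, rfl⟩
    rw [joinSeq_even, joinSeq_odd]
    exact ⟨hY, hZ⟩
  · rintro ⟨h1, h2⟩
    exact ⟨_, h1, _, h2, joinSeq_eta X⟩

theorem mem_openOf_half (b : ℕ) (S : Set Str) (X : Cantor) :
    (fun i => X (2 * i + b)) ∈ openOf S ↔ X ∈ openOf {σ | half b σ ∈ S} := by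
  constructor
  · rintro ⟨σ, hσ, hp⟩
    refine ⟨restr X (2 * σ.length + b), ?_, prefixOf_restr _ _⟩
    have : (2 * σ.length + b + 1 - b) / 2 = σ.length := by omega
    simp only [Set.mem_ofPred_eq, half_restr, this]
    rwa [show restr _ σ.length = σ from hp]
  · rintro ⟨σ, hσ, hp⟩
    refine ⟨half b σ, hσ, ?_⟩
    rw [← show restr X σ.length = σ from hp, half_restr]
    exact prefixOf_restr _ _

theorem isPi01_supClass {C D : Set Cantor} (hC : IsPi01 C) (hD : IsPi01 D) :
    IsPi01 (supClass C D) := by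
  obtain ⟨S, hS, rfl⟩ := hC
  obtain ⟨T, hT, rfl⟩ := hD
  refine ⟨{σ | half 0 σ ∈ S ∨ half 1 σ ∈ T}, ?_, ?_⟩
  · exact re_or (re_comp hS (primrec_half 0).to_comp) (re_comp hT (primrec_half 1).to_comp)
  · ext X
    rw [mem_supClass, Set.mem_compl_iff, Set.mem_compl_iff, Set.mem_compl_iff,
      mem_openOf_half 0, mem_openOf_half 1, ← not_or]
    simp only [openOf, Set.mem_ofPred_eq, or_and_right, exists_or]

/-- Interleaving of two strings, cut off where the shorter one ends. -/
def weave (σ τ : Str) : Str :=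
  (List.range (2 * min σ.length τ.length)).map fun i =>
    if i % 2 = 0 then σ.getD (i / 2) false else τ.getD (i / 2) false

theorem primrec_weave : Primrec₂ weave := by
  change Primrec fun p : Str × Str => weave p.1 p.2
  unfold weave
  refine Primrec.list_map ?_ ?_
  · refine Primrec.list_range.comp (Primrec.nat_mul.comp (Primrec.const 2) ?_)
    exact Primrec.nat_min.comp (Primrec.list_length.comp Primrec.fst)
      (Primrec.list_length.comp Primrec.snd)
  · change Primrec fun x : (Str × Str) × ℕ =>
      if x.2 % 2 = 0 then x.1.1.getD (x.2 / 2) false else x.1.2.getD (x.2 / 2) false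
    refine Primrec.ite ?_ ?_ ?_
    · exact Primrec.eq.comp (Primrec.nat_mod.comp Primrec.snd (Primrec.const 2)) (Primrec.const 0)
    · exact (Primrec.list_getD false).comp (Primrec.fst.comp Primrec.fst)
        (Primrec.nat_div.comp Primrec.snd (Primrec.const 2))
    · exact (Primrec.list_getD false).comp (Primrec.snd.comp Primrec.fst)
        (Primrec.nat_div.comp Primrec.snd (Primrec.const 2))

theorem comparable_weave {σ σ' τ τ' : Str} (h1 : Comparable σ σ') (h2 : Comparable τ τ') :
    Comparable (weave σ τ) (weave σ' τ') := by
  rw [comparable_iff] at h1 h2 ⊢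
  intro i hi hi'
  have h3 : i < 2 * min σ.length τ.length := by simpa [weave] using hi
  have h4 : i < 2 * min σ'.length τ'.length := by simpa [weave] using hi'
  have a1 : i / 2 < σ.length := by omega
  have a2 : i / 2 < σ'.length := by omega
  have a3 : i / 2 < τ.length := by omega
  have a4 : i / 2 < τ'.length := by omega
  simp [weave, a1, a2, a3, a4, h1 _ a1 a2, h2 _ a3 a4]

theorem restr_joinSeq_prefix {A B : Cantor} {n : ℕ} {σ τ : Str} (h1 : restr A n <+: σ)
    (h2 : restr B n <+: τ) : restr (joinSeq A B) n <+: weave σ τ := by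
  have l1 : n ≤ σ.length := by simpa [length_restr] using h1.length_le
  have l2 : n ≤ τ.length := by simpa [length_restr] using h2.length_le
  refine prefix_of_getElem ?_ fun i hi => ?_
  · simp only [length_restr, weave, List.length_map, List.length_range]; omega
  · rw [length_restr] at hi
    have a1 : i / 2 < (restr A n).length := by rw [length_restr]; omega
    have a2 : i / 2 < (restr B n).length := by rw [length_restr]; omega
    have b1 : i / 2 < σ.length := by omega
    have b2 : i / 2 < τ.length := by omega
    have e1 := h1.getElem a1
    have e2 := h2.getElem a2
    simp only [restr, List.getElem_map, List.getElem_range] at e1 e2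
    simp [restr, weave, joinSeq, b1, b2, ← e1, ← e2]

theorem supClass_le {C D E : Set Cantor} (h1 : MedvedevLE C E) (h2 : MedvedevLE D E) :
    MedvedevLE (supClass C D) E := by
  obtain ⟨Φ, ⟨hΦ, cΦ⟩, mΦ⟩ := h1
  obtain ⟨Ψ, ⟨hΨ, cΨ⟩, mΨ⟩ := h2
  refine ⟨{p | ∃ q r : Str × Str, q ∈ Φ ∧ r ∈ Ψ ∧ q.1 <+: p.1 ∧ r.1 <+: p.1 ∧
    p.2 = weave q.2 r.2}, ⟨?_, ?_⟩, ?_⟩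
  · refine re_exists (p := fun (p q : Str × Str) => ∃ r : Str × Str, q ∈ Φ ∧ r ∈ Ψ ∧
      q.1 <+: p.1 ∧ r.1 <+: p.1 ∧ p.2 = weave q.2 r.2) ?_
    refine re_exists (p := fun (x : (Str × Str) × (Str × Str)) (r : Str × Str) =>
      x.2 ∈ Φ ∧ r ∈ Ψ ∧ x.2.1 <+: x.1.1 ∧ r.1 <+: x.1.1 ∧ x.1.2 = weave x.2.2 r.2) ?_
    have f1 : Primrec fun y : ((Str × Str) × (Str × Str)) × (Str × Str) => y.1.1 :=
      Primrec.fst.comp Primrec.fst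
    have f2 : Primrec fun y : ((Str × Str) × (Str × Str)) × (Str × Str) => y.1.2 :=
      Primrec.snd.comp Primrec.fst
    have f3 : Primrec fun y : ((Str × Str) × (Str × Str)) × (Str × Str) => y.2 := Primrec.snd
    refine re_and (re_comp hΦ f2.to_comp) (re_and (re_comp hΨ f3.to_comp)
      (re_and (re_of_primrec ?_) (re_and (re_of_primrec ?_) (re_of_primrec ?_))))
    · exact primrec_prefix (Primrec.fst.comp f2) (Primrec.fst.comp f1)
    · exact primrec_prefix (Primrec.fst.comp f3) (Primrec.fst.comp f1)
    · exact Primrec.eq.comp (Primrec.snd.comp f1)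
        (primrec_weave.comp (Primrec.snd.comp f2) (Primrec.snd.comp f3))
  · rintro σ τ σ' τ' ⟨⟨q1, q2⟩, ⟨r1, r2⟩, hq, hr, pq, pr, rfl⟩
      ⟨⟨q1', q2'⟩, ⟨r1', r2'⟩, hq', hr', pq', pr', rfl⟩ hσ
    have hc : Comparable σ σ' := Or.inl hσ
    exact comparable_weave (cΦ.comparable hq hq' (hc.of_prefix pq pq'))
      (cΨ.comparable hr hr' (hc.of_prefix pr pr'))
  · intro X hX
    obtain ⟨A, hA, mA⟩ := mΦ X hX
    obtain ⟨B, hB, mB⟩ := mΨ X hX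
    refine ⟨joinSeq A B, ⟨A, hA, B, hB, rfl⟩, fun n => ?_⟩
    rcases mA n with h | ⟨σ, τ, hm, hp, ht⟩
    · left
      have : n = 0 := by simpa [length_restr] using congrArg List.length h
      subst this; rfl
    rcases mB n with h | ⟨σ', τ', hm', hp', ht'⟩
    · left
      have : n = 0 := by simpa [length_restr] using congrArg List.length h
      subst this; rfl
    refine Or.inr ⟨restr X (max σ.length σ'.length), weave τ τ',
      ⟨(σ, τ), (σ', τ'), hm, hm', ?_, ?_, rfl⟩, prefixOf_restr _ _, restr_joinSeq_prefix ht ht'⟩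
    · have := restr_prefix X (le_max_left σ.length σ'.length)
      rwa [show restr X σ.length = σ from hp] at this
    · have := restr_prefix X (le_max_right σ.length σ'.length)
      rwa [show restr X σ'.length = σ' from hp'] at this

/-! ### The lattice of Medvedev degrees of `Π⁰₁` classes -/

/-- The type of `Π⁰₁` classes. -/
structure Pi01Class where
  carrier : Set Cantor
  isPi01 : IsPi01 carrier

namespace Pi01Class

/-- `Π⁰₁` classes are preordered by Medvedev reducibility. -/
instance : Preorder Pi01Class where
  le C D := MedvedevLE C.carrier D.carrier
  le_refl C := medvedevLE_refl C.carrier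
  le_trans _ _ _ := medvedevLE_trans

/-- The `Π⁰₁` class `inf(C, D)`. -/
def inf (C D : Pi01Class) : Pi01Class :=
  ⟨infClass C.carrier D.carrier, isPi01_infClass C.isPi01 D.isPi01⟩

/-- The `Π⁰₁` class `sup(C, D)`. -/
def sup (C D : Pi01Class) : Pi01Class :=
  ⟨supClass C.carrier D.carrier, isPi01_supClass C.isPi01 D.isPi01⟩

theorem inf_le_left (C D : Pi01Class) : inf C D ≤ C :=
  medvedevLE_cons false Set.subset_union_left

theorem inf_le_right (C D : Pi01Class) : inf C D ≤ D :=
  medvedevLE_cons true Set.subset_union_right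

theorem le_inf {C D E : Pi01Class} (h1 : E ≤ C) (h2 : E ≤ D) : E ≤ inf C D := le_infClass h1 h2

theorem le_sup_left (C D : Pi01Class) : C ≤ sup C D :=
  medvedevLE_half 0 fun _ hX => (mem_supClass.1 hX).1

theorem le_sup_right (C D : Pi01Class) : D ≤ sup C D :=
  medvedevLE_half 1 fun _ hX => (mem_supClass.1 hX).2

theorem sup_le {C D E : Pi01Class} (h1 : C ≤ E) (h2 : D ≤ E) : sup C D ≤ E := supClass_le h1 h2

end Pi01Class

/-- The Medvedev degrees of `Π⁰₁` classes: the quotient of the preorder of `Π⁰₁` classes by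
Medvedev equivalence, with the induced order. -/
abbrev MedvedevDegree : Type := Antisymmetrization Pi01Class (· ≤ ·)

/-- The Medvedev degree of a `Π⁰₁` class. -/
def degree (C : Pi01Class) : MedvedevDegree := toAntisymmetrization (· ≤ ·) C

/-- The lattice `E_s`; its operations are induced by `inf` and `sup` of classes. -/
instance : Lattice MedvedevDegree where
  inf := Quotient.map₂ Pi01Class.inf fun _ _ h _ _ h' =>
    ⟨Pi01Class.le_inf ((Pi01Class.inf_le_left _ _).trans h.1)
        ((Pi01Class.inf_le_right _ _).trans h'.1),
      Pi01Class.le_inf ((Pi01Class.inf_le_left _ _).trans h.2)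
        ((Pi01Class.inf_le_right _ _).trans h'.2)⟩
  sup := Quotient.map₂ Pi01Class.sup fun _ _ h _ _ h' =>
    ⟨Pi01Class.sup_le (h.1.trans (Pi01Class.le_sup_left _ _))
        (h'.1.trans (Pi01Class.le_sup_right _ _)),
      Pi01Class.sup_le (h.2.trans (Pi01Class.le_sup_left _ _))
        (h'.2.trans (Pi01Class.le_sup_right _ _))⟩
  inf_le_left a b := Quotient.inductionOn₂ a b Pi01Class.inf_le_left
  inf_le_right a b := Quotient.inductionOn₂ a b Pi01Class.inf_le_right
  le_inf a b c := Quotient.inductionOn₃ a b c fun _ _ _ => Pi01Class.le_inf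
  le_sup_left a b := Quotient.inductionOn₂ a b Pi01Class.le_sup_left
  le_sup_right a b := Quotient.inductionOn₂ a b Pi01Class.le_sup_right
  sup_le a b c := Quotient.inductionOn₃ a b c fun _ _ _ => Pi01Class.sup_le

/-- A filter in a lattice: a subset which is closed upwards and closed under `inf`. -/
def IsLatticeFilter {L : Type} [Lattice L] (F : Set L) : Prop :=
  (∀ x y : L, x ∈ F → x ≤ y → y ∈ F) ∧ ∀ x y : L, x ∈ F → y ∈ F → x ⊓ y ∈ F

/-- The Medvedev degrees of deep `Π⁰₁` classes. -/
def deepDegrees : Set MedvedevDegree := {d | ∃ C : Pi01Class, IsDeep C.carrier ∧ degree C = d}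

end DeepClasses

/-!
The a priori semi-measure `M` dominates, up to a factor `2 ^ c`, the semi-measure induced by any
Turing functional `Φ_e`, because simulating `Φ_e` costs the `e + 1` bits of the prefix `1 ^ e 0`.
Distinct strings of the same length are never both prefixes of one output, so `M` sums over a level
of a tree to the probability that the universal functional outputs some string of this level, which
decreases with the level. Hence if a Turing functional sends every string of a set `S` of strings of
equal length to an extension of a string of `S'`, composing it with the universal functional gives
`M(S) ≤ 2 ^ c * M(S')`.

Let `C ≤ₛ D` via `Φ`. By compactness of Cantor space, where the c.e. complement of `D` lets a search
recognise that all of `D` has been treated, some computable `u` is such that `Φ` produces `n` bits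
from the first `u n` bits of every member of `D`. Thus `Φ` maps level `u n` of `D` into level `n` of
`C`, and `M(D_(u n)) ≤ 2 ^ c * M(C_n)`. For `inf(C, D)`, the functional deleting the first bit maps
level `n + 1` into the union of the levels `n` of `C` and `D`.
-/

namespace DeepClasses

open MeasureTheory ProbabilityTheory

section Computability

open Nat.Partrec (Code)

variable {α β : Type} [Primcodable α] [Primcodable β]

theorem exists_code_of_rePred {p : α → Prop} (hp : REPred p) :
    ∃ c : Code, ∀ n a, Encodable.decode n = some a →
      ((∃ k, (Code.evaln k c n).isSome) ↔ p a) := by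
  obtain ⟨c, hc⟩ := Code.exists_code.1 hp
  refine ⟨c, fun n a ha => ?_⟩
  have hdom : (c.eval n).Dom ↔ p a := by simp [hc, ha, Part.assert]
  rw [← hdom, Part.dom_iff_mem]
  simp only [Code.evaln_complete, Option.isSome_iff_exists, Option.mem_def]
  exact exists_comm

theorem re_normal_primrec {p : α → Prop} (hp : REPred p) :
    ∃ f : α → ℕ → Bool, Primrec₂ f ∧ (∀ a m n, m ≤ n → f a m = true → f a n = true) ∧
      ∀ a, p a ↔ ∃ n, f a n = true := by
  obtain ⟨c, hc⟩ := exists_code_of_rePred hp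
  refine ⟨fun a k => (Code.evaln k c (Encodable.encode a)).isSome, ?_, fun a m n hmn h => ?_,
    fun a => (hc _ a (Encodable.encodek a)).symm⟩
  · exact Primrec.option_isSome.comp (Code.primrec_evaln.comp
      ((Primrec.snd.pair (Primrec.const c)).pair (Primrec.encode.comp Primrec.fst)))
  · obtain ⟨x, hx⟩ := Option.isSome_iff_exists.1 h
    exact Option.isSome_iff_exists.2 ⟨x, Code.evaln_mono hmn hx⟩

theorem re_forall_mem_list {p : α → β → Prop} (hp : REPred fun x : α × β => p x.1 x.2)
    {l : α → List β} (hl : Primrec l) : REPred fun a => ∀ b ∈ l a, p a b := by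
  obtain ⟨f, hf, hmono, hfp⟩ := re_normal_primrec hp
  have hR : PrimrecRel fun (b : β) (y : α × ℕ) => f (y.1, b) y.2 = true :=
    Primrec.eq.comp (hf.comp ((Primrec.fst.comp Primrec.snd).pair Primrec.fst)
      (Primrec.snd.comp Primrec.snd)) (Primrec.const true)
  have hstage : PrimrecPred fun y : α × ℕ => ∀ b ∈ l y.1, f (y.1, b) y.2 = true :=
    hR.forall_mem_list.comp (hl.comp Primrec.fst) Primrec.id
  refine (re_exists (p := fun a t => ∀ b ∈ l a, f (a, b) t = true)
    (re_of_primrec hstage)).of_eq fun a => ⟨?_, fun h => ?_⟩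
  · rintro ⟨t, ht⟩ b hb
    exact (hfp (a, b)).2 ⟨t, ht b hb⟩
  · choose! g hg using fun b hb => (hfp (a, b)).1 (h b hb)
    exact ⟨((l a).map g).sum, fun b hb => hmono _ _ _
      (List.single_le_sum (by simp) _ (List.mem_map_of_mem hb)) (hg b hb)⟩

theorem exists_computable_choice {p : α → β → Prop} (hp : REPred fun x : α × β => p x.1 x.2)
    (h : ∀ a, ∃ b, p a b) : ∃ u : α → β, Computable u ∧ ∀ a, p a (u a) := by
  obtain ⟨f, hf, hfp⟩ := re_normal hp
  let search (a : α) (k : ℕ) : Option β :=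
    (Encodable.decode k.unpair.1).bind fun b => bif f (a, b) k.unpair.2 then some b else none
  have hu : Computable fun x : α × ℕ => x.2.unpair := Computable.unpair.comp Computable.snd
  have hsearch : Computable₂ search :=
    Computable.option_bind (Computable.decode.comp (Computable.fst.comp hu)) <|
      Computable.cond (hf.comp ((Computable.fst.comp Computable.fst).pair Computable.snd)
        (Computable.snd.comp (hu.comp Computable.fst)))
        (Computable.option_some.comp Computable.snd) (Computable.const none)
  have hdom (a : α) : (Nat.rfindOpt (search a)).Dom := by
    obtain ⟨b, hb⟩ := h a
    obtain ⟨t, ht⟩ := (hfp (a, b)).1 hb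
    exact Nat.rfindOpt_dom.2 ⟨Nat.pair (Encodable.encode b) t, b, by simp [search, ht]⟩
  have hfound (a : α) (k : ℕ) (b : β) (hb : search a k = some b) : p a b := by
    obtain ⟨b', -, hb'⟩ := Option.bind_eq_some_iff.1 hb
    cases hf' : f (a, b') k.unpair.2 <;> simp only [hf', cond_true, cond_false, reduceCtorEq,
      Option.some.injEq] at hb'
    exact hb' ▸ (hfp (a, b')).2 ⟨_, hf'⟩
  refine ⟨fun a => (Nat.rfindOpt (search a)).get (hdom a),
    (Partrec.rfindOpt hsearch).of_eq fun a => (Part.some_get (hdom a)).symm, fun a => ?_⟩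
  obtain ⟨k, hk⟩ := Nat.rfindOpt_spec (Part.get_mem (hdom a))
  exact hfound a k _ hk

theorem computable_findGreatest {f : α → ℕ} {p : α → ℕ → Prop} [∀ a k, Decidable (p a k)]
    (hf : Computable f) (hp : Computable₂ fun a k => decide (p a k)) :
    Computable fun a => (f a).findGreatest (p a) := by
  have hk : Computable fun x : α × ℕ × ℕ => x.2.1 + 1 :=
    Computable.succ.comp (Computable.fst.comp Computable.snd)
  have hstep : Computable₂ fun (a : α) (y : ℕ × ℕ) =>
      bif decide (p a (y.1 + 1)) then y.1 + 1 else y.2 :=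
    Computable.cond (hp.comp Computable.fst hk) hk (Computable.snd.comp Computable.snd)
  refine (Computable.nat_rec hf (Computable.const 0) hstep).of_eq fun a => ?_
  induction f a with
  | zero => rfl
  | succ n ih =>
    rw [Nat.findGreatest_succ, ← ih]
    by_cases h : p a (n + 1) <;> simp [h]

end Computability

theorem PrefixOf.of_prefix {σ τ : Str} {X : Cantor} (h : PrefixOf τ X) (hp : σ <+: τ) :
    PrefixOf σ X := by
  rw [prefixOf_iff] at h ⊢
  exact fun i hi => (hp.getElem hi).trans (h i (hi.trans_le hp.length_le))

theorem Comparable.eq_of_length {σ τ : Str} (h : Comparable σ τ) (hl : σ.length = τ.length) :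
    σ = τ :=
  h.elim (fun h => h.eq_of_length hl) fun h => (h.eq_of_length hl.symm).symm

/-! ### Functionals on finite oracles -/

/-- `Φ^σ ⪰ τ`: the functional `Φ` produces at least `τ` from the finite oracle `σ`. -/
def StringOutputs (Φ : Set (Str × Str)) (σ τ : Str) : Prop :=
  τ = [] ∨ ∃ σ' τ' : Str, (σ', τ') ∈ Φ ∧ σ' <+: σ ∧ τ <+: τ'

namespace StringOutputs

variable {Φ : Set (Str × Str)} {σ σ' τ τ' : Str}

theorem of_mem (h : (σ, τ) ∈ Φ) : StringOutputs Φ σ τ :=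
  Or.inr ⟨σ, τ, h, List.prefix_rfl, List.prefix_rfl⟩

theorem extend (h : StringOutputs Φ σ τ) (hσ : σ <+: σ') : StringOutputs Φ σ' τ :=
  h.imp_right fun ⟨ρ, υ, hm, hρ, hυ⟩ => ⟨ρ, υ, hm, hρ.trans hσ, hυ⟩

theorem of_prefix (h : StringOutputs Φ σ τ) (hτ : τ' <+: τ) : StringOutputs Φ σ τ' := by
  rcases h with rfl | ⟨ρ, υ, hm, hρ, hυ⟩
  · exact Or.inl (List.prefix_nil.1 hτ)
  · exact Or.inr ⟨ρ, υ, hm, hρ, hτ.trans hυ⟩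

theorem comparable (hΦ : Consistent Φ) (h : StringOutputs Φ σ τ) (h' : StringOutputs Φ σ' τ')
    (hσ : Comparable σ σ') : Comparable τ τ' := by
  rcases h with rfl | ⟨ρ, υ, hm, hρ, hυ⟩
  · exact Or.inl List.nil_prefix
  rcases h' with rfl | ⟨ρ', υ', hm', hρ', hυ'⟩
  · exact Or.inr List.nil_prefix
  exact (hΦ.comparable hm hm' (hσ.of_prefix hρ hρ')).of_prefix hυ hυ'

end StringOutputs

theorem re_stringOutputs {Φ : Set (Str × Str)} (hΦ : REPred fun p => p ∈ Φ) :
    REPred fun x : Str × Str => StringOutputs Φ x.1 x.2 := by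
  have hprefix : PrimrecPred fun y : (Str × Str) × (Str × Str) =>
      y.2.1 <+: y.1.1 ∧ y.1.2 <+: y.2.2 :=
    (primrec_prefix (Primrec.fst.comp Primrec.snd) (Primrec.fst.comp Primrec.fst)).and
      (primrec_prefix (Primrec.snd.comp Primrec.fst) (Primrec.snd.comp Primrec.snd))
  refine (re_or (re_of_primrec (Primrec.eq.comp Primrec.snd (Primrec.const [])))
    (re_exists (p := fun (x p : Str × Str) => p ∈ Φ ∧ p.1 <+: x.1 ∧ x.2 <+: p.2)
      (re_and (re_comp hΦ Computable.snd) (re_of_primrec hprefix)))).of_eq fun x => ?_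
  simp only [StringOutputs, Prod.exists]

theorem outputs_iff_exists_restr {Φ : Set (Str × Str)} {X : Cantor} {τ : Str} :
    Outputs Φ X τ ↔ ∃ n, StringOutputs Φ (restr X n) τ := by
  constructor
  · rintro (rfl | ⟨σ, τ', hm, hσ, hτ⟩)
    · exact ⟨0, Or.inl rfl⟩
    · exact ⟨σ.length, (hσ.symm ▸ StringOutputs.of_mem hm).of_prefix hτ⟩
  · rintro ⟨n, rfl | ⟨σ, τ', hm, hσ, hτ⟩⟩
    · exact Or.inl rfl
    · exact Or.inr ⟨σ, τ', hm, (prefixOf_restr X n).of_prefix hσ, hτ⟩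

theorem comparable_restr (X : Cantor) (m n : ℕ) : Comparable (restr X m) (restr X n) :=
  (le_total m n).imp (restr_prefix X) (restr_prefix X)

theorem Outputs.of_prefix {Φ : Set (Str × Str)} {X : Cantor} {σ τ : Str} (h : Outputs Φ X τ)
    (hp : σ <+: τ) : Outputs Φ X σ :=
  let ⟨n, hn⟩ := outputs_iff_exists_restr.1 h
  outputs_iff_exists_restr.2 ⟨n, hn.of_prefix hp⟩

theorem Outputs.comparable {Φ : Set (Str × Str)} (hΦ : Consistent Φ) {X : Cantor} {σ τ : Str}
    (hσ : Outputs Φ X σ) (hτ : Outputs Φ X τ) : Comparable σ τ :=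
  let ⟨m, hm⟩ := outputs_iff_exists_restr.1 hσ
  let ⟨n, hn⟩ := outputs_iff_exists_restr.1 hτ
  hm.comparable hΦ hn (comparable_restr X m n)

/-- The composition of two functionals: `Ψ` is applied to the strings which `Φ` produces. -/
def compFunctional (Ψ Φ : Set (Str × Str)) : Set (Str × Str) :=
  {p | ∃ τ : Str, StringOutputs Φ p.1 τ ∧ (τ, p.2) ∈ Ψ}

theorem IsTuringFunctional.comp {Ψ Φ : Set (Str × Str)} (hΨ : IsTuringFunctional Ψ)
    (hΦ : IsTuringFunctional Φ) : IsTuringFunctional (compFunctional Ψ Φ) := by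
  constructor
  · refine re_exists (p := fun (p : Str × Str) (τ : Str) => StringOutputs Φ p.1 τ ∧ (τ, p.2) ∈ Ψ)
      (re_and ?_ ?_)
    · exact re_comp (re_stringOutputs hΦ.1) (f := fun x : (Str × Str) × Str => (x.1.1, x.2))
        ((Computable.fst.comp Computable.fst).pair Computable.snd)
    · exact re_comp hΨ.1 (f := fun x : (Str × Str) × Str => (x.2, x.1.2))
        (Computable.snd.pair (Computable.snd.comp Computable.fst))
  · rintro σ υ σ' υ' ⟨τ, hτ, hυ⟩ ⟨τ', hτ', hυ'⟩ hσ
    exact hΨ.2.comparable hυ hυ' (hτ.comparable hΦ.2 hτ' (Or.inl hσ))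

theorem Outputs.comp {Ψ Φ : Set (Str × Str)} {X : Cantor} {σ τ : Str} (h : Outputs Φ X σ)
    (hΨ : StringOutputs Ψ σ τ) : Outputs (compFunctional Ψ Φ) X τ := by
  rcases hΨ with rfl | ⟨σ', τ', hm, hσ, hτ⟩
  · exact Or.inl rfl
  obtain ⟨n, hn⟩ := outputs_iff_exists_restr.1 h
  have hcomp : StringOutputs (compFunctional Ψ Φ) (restr X n) τ' :=
    .of_mem ⟨σ', hn.of_prefix hσ, hm⟩
  exact outputs_iff_exists_restr.2 ⟨n, hcomp.of_prefix hτ⟩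

/-! ### The universal functional -/

theorem Consistent.insert {Φ : Set (Str × Str)} (hΦ : Consistent Φ) {p : Str × Str}
    (hp : ∀ q ∈ Φ, Comparable p.1 q.1 → Comparable p.2 q.2) : Consistent (insert p Φ) := by
  rintro σ τ σ' τ' (rfl | h) h' hσ
  · rcases h' with h' | h'
    · obtain ⟨-, rfl⟩ := Prod.mk.inj h'
      exact Or.inl List.prefix_rfl
    · exact hp _ h' (Or.inl hσ)
  · rcases h' with rfl | h'
    · exact (hp _ h (Or.inr hσ)).symm
    · exact hΦ _ _ _ _ h h' hσ

theorem Consistent.iUnion {Φ : ℕ → Set (Str × Str)} (hmono : Monotone Φ)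
    (hΦ : ∀ s, Consistent (Φ s)) : Consistent (⋃ s, Φ s) := by
  intro σ τ σ' τ' h h' hσ
  obtain ⟨s, hs⟩ := Set.mem_iUnion.1 h
  obtain ⟨t, ht⟩ := Set.mem_iUnion.1 h'
  exact hΦ (max s t) _ _ _ _ (hmono (le_max_left s t) hs) (hmono (le_max_right s t) ht) hσ

/-- One step of the acceptance procedure: the pair `o`, if there is one, is added to the list `L`
of pairs accepted so far if this keeps the list consistent. -/
def acceptStep (L : List (Str × Str)) (o : Option (Str × Str)) : List (Str × Str) :=
  o.elim L fun p => if ∀ q ∈ L, Comparable p.1 q.1 → Comparable p.2 q.2 then p :: L else L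

theorem accepted_succ (e s : ℕ) :
    accepted e (s + 1) = acceptStep (accepted e s) (candidate e s) := by
  rw [accepted]
  cases candidate e s <;> rfl

theorem subset_acceptStep (L : List (Str × Str)) (o : Option (Str × Str)) :
    L ⊆ acceptStep L o := by
  rcases o with _ | p
  · exact List.Subset.refl L
  · rw [acceptStep, Option.elim_some]
    split_ifs
    · exact List.subset_cons_self p L
    · exact List.Subset.refl L

theorem mem_or_eq_some_of_mem_acceptStep {L : List (Str × Str)} {o : Option (Str × Str)}
    {p : Str × Str} (hp : p ∈ acceptStep L o) : p ∈ L ∨ o = some p := by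
  rcases o with _ | q
  · exact Or.inl hp
  · rw [acceptStep, Option.elim_some] at hp
    split_ifs at hp
    · exact (List.mem_cons.1 hp).elim (fun h => Or.inr (congrArg some h.symm)) Or.inl
    · exact Or.inl hp

theorem consistent_acceptStep {L : List (Str × Str)} (hL : Consistent {p | p ∈ L})
    (o : Option (Str × Str)) : Consistent {p | p ∈ acceptStep L o} := by
  rcases o with _ | p
  · exact hL
  · rw [acceptStep, Option.elim_some]
    split_ifs with hp
    · simpa only [List.mem_cons, Set.insert_def, Set.mem_ofPred_eq] using hL.insert hp
    · exact hL

theorem monotone_accepted (e : ℕ) : Monotone fun s => {p | p ∈ accepted e s} :=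
  monotone_nat_of_le_succ fun s p hp => by
    simpa only [accepted_succ, Set.mem_ofPred_eq] using subset_acceptStep _ (candidate e s) hp

theorem consistent_accepted (e s : ℕ) : Consistent {p | p ∈ accepted e s} := by
  induction s with
  | zero =>
    intro σ τ _ _ h
    exact absurd h List.not_mem_nil
  | succ s ih =>
    rw [accepted_succ]
    exact consistent_acceptStep ih _

theorem consistent_functional (e : ℕ) : Consistent (functional e) := by
  have hunion : functional e = ⋃ s, {p | p ∈ accepted e s} := Set.ofPred_exists _
  exact hunion ▸ Consistent.iUnion (monotone_accepted e) (consistent_accepted e)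

theorem exists_candidate_of_mem_accepted {e s : ℕ} {p : Str × Str} (hp : p ∈ accepted e s) :
    ∃ t, candidate e t = some p := by
  induction s with
  | zero => exact absurd hp List.not_mem_nil
  | succ s ih =>
    rw [accepted_succ] at hp
    exact (mem_or_eq_some_of_mem_acceptStep hp).elim ih fun h => ⟨s, h⟩

theorem functional_eq_of_consistent {e : ℕ}
    (h : Consistent {p | ∃ s, candidate e s = some p}) :
    functional e = {p | ∃ s, candidate e s = some p} := by
  refine Set.Subset.antisymm (fun p ⟨s, hs⟩ => exists_candidate_of_mem_accepted hs) ?_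
  rintro p ⟨s, hs⟩
  refine ⟨s + 1, ?_⟩
  rw [accepted_succ, hs, acceptStep, Option.elim_some, if_pos]
  · exact List.mem_cons_self
  · exact fun q hq => h.comparable ⟨s, hs⟩ (exists_candidate_of_mem_accepted hq)

theorem exists_candidate_eq_some_iff {p : Str × Str → Prop} (hp : REPred p) :
    ∃ e, ∀ q, (∃ s, candidate e s = some q) ↔ p q := by
  obtain ⟨c, hc⟩ := exists_code_of_rePred hp
  refine ⟨Encodable.encode c, fun q => ⟨?_, fun hq => ?_⟩⟩
  · rintro ⟨s, hs⟩
    rw [candidate, Denumerable.ofNat_encode] at hs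
    obtain ⟨x, hx, hq⟩ := Option.bind_eq_some_iff.1 hs
    exact (hc _ q hq).1 ⟨s.unpair.2, Option.isSome_iff_exists.2 ⟨x, hx⟩⟩
  · obtain ⟨k, hk⟩ := (hc _ q (Encodable.encodek q)).2 hq
    obtain ⟨x, hx⟩ := Option.isSome_iff_exists.1 hk
    exact ⟨Nat.pair (Encodable.encode q) k, by simp [candidate, hx]⟩

theorem exists_functional_eq {Φ : Set (Str × Str)} (hΦ : IsTuringFunctional Φ) :
    ∃ e, functional e = Φ := by
  obtain ⟨e, he⟩ := exists_candidate_eq_some_iff hΦ.1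
  obtain rfl : {p | ∃ s, candidate e s = some p} = Φ := Set.ext he
  exact ⟨e, functional_eq_of_consistent hΦ.2⟩

theorem primrecRel_comparable : PrimrecRel Comparable :=
  (primrec_prefix Primrec.fst Primrec.snd).or (primrec_prefix Primrec.snd Primrec.fst)

theorem primrec_candidate : Primrec₂ candidate := by
  have hs : Primrec fun x : ℕ × ℕ => x.2.unpair := Primrec.unpair.comp Primrec.snd
  refine Primrec.option_bind ?_ (Primrec.decode.comp (Primrec.fst.comp (hs.comp Primrec.fst)))
  exact Nat.Partrec.Code.primrec_evaln.comp
    (((Primrec.snd.comp hs).pair ((Primrec.ofNat _).comp Primrec.fst)).pair (Primrec.fst.comp hs))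

theorem primrec_acceptStep : Primrec₂ acceptStep := by
  have hR : PrimrecRel fun (q p : Str × Str) => Comparable p.1 q.1 → Comparable p.2 q.2 := by
    have h₁ : PrimrecRel fun (q p : Str × Str) => Comparable p.1 q.1 :=
      primrecRel_comparable.comp (Primrec.fst.comp Primrec.snd) (Primrec.fst.comp Primrec.fst)
    have h₂ : PrimrecRel fun (q p : Str × Str) => Comparable p.2 q.2 :=
      primrecRel_comparable.comp (Primrec.snd.comp Primrec.snd) (Primrec.snd.comp Primrec.fst)
    exact (h₁.not.or h₂).of_eq fun x => imp_iff_not_or.symm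
  have hL : Primrec fun y : (List (Str × Str) × Option (Str × Str)) × (Str × Str) => y.1.1 :=
    Primrec.fst.comp Primrec.fst
  have hsome : Primrec₂ fun (x : List (Str × Str) × Option (Str × Str)) (p : Str × Str) =>
      if ∀ q ∈ x.1, Comparable p.1 q.1 → Comparable p.2 q.2 then p :: x.1 else x.1 :=
    Primrec.ite (hR.forall_mem_list.comp hL Primrec.snd)
      (Primrec.list_cons.comp Primrec.snd hL) hL
  refine (Primrec.option_casesOn Primrec.snd Primrec.fst hsome).of_eq fun x => ?_
  rcases x with ⟨L, _ | p⟩ <;> rfl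

theorem primrec_accepted : Primrec₂ accepted := by
  refine (Primrec.nat_rec (f := fun _ : ℕ => ([] : List (Str × Str)))
    (g := fun (e : ℕ) (y : ℕ × List (Str × Str)) => acceptStep y.2 (candidate e y.1))
    (Primrec.const _) (primrec_acceptStep.comp (Primrec.snd.comp Primrec.snd)
      (primrec_candidate.comp Primrec.fst (Primrec.fst.comp Primrec.snd)))).of_eq fun e s => ?_
  induction s with
  | zero => rfl
  | succ s ih => rw [accepted_succ, ← ih]

theorem re_mem_functional : REPred fun x : ℕ × (Str × Str) => x.2 ∈ functional x.1 := by
  have hmem : PrimrecRel fun (L : List (Str × Str)) (p : Str × Str) => ∃ q ∈ L, q = p :=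
    PrimrecRel.exists_mem_list Primrec.eq
  refine (re_exists (p := fun (x : ℕ × (Str × Str)) (s : ℕ) => ∃ q ∈ accepted x.1 s, q = x.2)
    (re_of_primrec (hmem.comp (primrec_accepted.comp (Primrec.fst.comp Primrec.fst) Primrec.snd)
      (Primrec.snd.comp Primrec.fst)))).of_eq fun x => ?_
  simp only [exists_eq_right, functional, Set.mem_ofPred_eq]

theorem primrec_replicate_append_cons :
    Primrec fun x : ℕ × Str => List.replicate x.1 true ++ false :: x.2 := by
  have hreplicate : Primrec fun n : ℕ => List.replicate n true :=
    (Primrec.list_map Primrec.list_range (Primrec.const true).to₂).of_eq fun n => by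
      rw [List.map_const', List.length_range]
  exact Primrec.list_append.comp (hreplicate.comp Primrec.fst)
    (Primrec.list_cons.comp (Primrec.const false) Primrec.snd)

theorem replicate_append_cons_prefix {e e' : ℕ} {σ σ' : Str}
    (h : List.replicate e true ++ false :: σ <+: List.replicate e' true ++ false :: σ') :
    e = e' ∧ σ <+: σ' := by
  induction e generalizing e' with
  | zero =>
    cases e' with
    | zero => simpa using h
    | succ e' => simp [List.replicate_succ] at h
  | succ e ih =>
    cases e' with
    | zero => simp [List.replicate_succ] at h
    | succ e' =>
      simp only [List.replicate_succ, List.cons_append, List.cons_prefix_cons, true_and] at h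
      exact (ih h).imp_left (congrArg _)

theorem isTuringFunctional_universal : IsTuringFunctional universalFunctional := by
  constructor
  · refine (re_exists (p := fun (p : Str × Str) (y : ℕ × Str) =>
      (y.2, p.2) ∈ functional y.1 ∧ p.1 = List.replicate y.1 true ++ false :: y.2)
      (re_and ?_ (re_of_primrec ?_))).of_eq fun p => Prod.exists
    · exact re_comp re_mem_functional
        (f := fun x : (Str × Str) × (ℕ × Str) => (x.2.1, x.2.2, x.1.2))
        ((Computable.fst.comp Computable.snd).pair ((Computable.snd.comp Computable.snd).pair
          (Computable.snd.comp Computable.fst)))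
    · exact Primrec.eq.comp (Primrec.fst.comp Primrec.fst)
        (primrec_replicate_append_cons.comp Primrec.snd)
  · rintro _ τ _ τ' ⟨e, σ, hτ, rfl⟩ ⟨e', σ', hτ', rfl⟩ h
    obtain ⟨rfl, hσ⟩ := replicate_append_cons_prefix h
    exact consistent_functional e _ _ _ _ hτ hτ' hσ

/-! ### Coin tossing and the a priori semi-measure -/

theorem infinitePi_pi_inter_shift {Ω : Type*} [MeasurableSpace Ω] (P : Measure Ω)
    [IsProbabilityMeasure P] (n : ℕ) {s : ℕ → Set Ω} (hs : ∀ i, MeasurableSet (s i))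
    {A : Set (ℕ → Ω)} (hA : MeasurableSet A) :
    Measure.infinitePi (fun _ : ℕ => P)
        (Set.pi (Finset.range n) s ∩ (fun X i => X (i + n)) ⁻¹' A) =
      (∏ i ∈ Finset.range n, P (s i)) * Measure.infinitePi (fun _ : ℕ => P) A := by
  let coord (i : ℕ) : MeasurableSpace (ℕ → Ω) := MeasurableSpace.comap (fun X => X i) inferInstance
  have hindep : Indep (⨆ i ∈ Set.Iio n, coord i) (⨆ i ∈ Set.Ici n, coord i)
      (Measure.infinitePi fun _ : ℕ => P) :=
    indep_iSup_of_disjoint (fun i => (measurable_pi_apply i).comap_le)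
      (iIndepFun_infinitePi fun _ => measurable_id).iIndep
      (Set.Iio_disjoint_Ici le_rfl)
  have hinit : MeasurableSet[⨆ i ∈ Set.Iio n, coord i] (Set.pi (Finset.range n) s) := by
    rw [Set.pi_def]
    exact Finset.measurableSet_biInter _ fun i hi =>
      le_iSup₂_of_le (f := fun i (_ : i ∈ Set.Iio n) => coord i) i (Finset.mem_range.1 hi) le_rfl _
        ⟨s i, hs i, rfl⟩
  have hshift : Measurable[⨆ i ∈ Set.Ici n, coord i] fun (X : ℕ → Ω) i => X (i + n) := by
    refine @measurable_pi_lambda _ _ _ (⨆ i ∈ Set.Ici n, coord i) _ _ fun i => ?_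
    exact Measurable.of_comap_le (le_iSup₂_of_le (f := fun i (_ : i ∈ Set.Ici n) => coord i)
      (i + n) (Nat.le_add_left n i) le_rfl)
  rw [(Indep_iff _ _ _).1 hindep _ _ hinit (hshift hA), Measure.infinitePi_pi _ fun i _ => hs i,
    ← Measure.map_apply (by fun_prop) hA,
    Measure.map_infinitePi_infinitePi_of_inj (add_left_injective n)]

theorem setOf_prefixOf_eq_pi (σ : Str) :
    {X | PrefixOf σ X} = Set.pi (Finset.range σ.length) fun i => {σ.getD i false} := by
  ext X
  simp only [Set.mem_ofPred_eq, prefixOf_iff, Set.mem_pi, Finset.mem_coe, Finset.mem_range,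
    Set.mem_singleton_iff]
  exact forall₂_congr fun i hi => by rw [List.getD_eq_getElem _ _ hi, eq_comm]

theorem measurableSet_prefixOf (σ : Str) : MeasurableSet {X | PrefixOf σ X} := by
  rw [setOf_prefixOf_eq_pi]
  exact MeasurableSet.pi (Finset.countable_toSet _) fun i _ => measurableSet_singleton _

theorem measurableSet_outputs (Φ : Set (Str × Str)) (τ : Str) :
    MeasurableSet {X | Outputs Φ X τ} := by
  have hunion : {X | Outputs Φ X τ} = {_X | τ = []} ∪
      ⋃ p : Str × Str, ({_X | p ∈ Φ ∧ τ <+: p.2} ∩ {X | PrefixOf p.1 X}) := by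
    ext X
    simp only [Outputs, Set.mem_ofPred_eq, Set.mem_union, Set.mem_iUnion, Set.mem_inter_iff,
      Prod.exists]
    exact or_congr Iff.rfl (exists₂_congr fun σ τ' => by tauto)
  rw [hunion]
  exact (MeasurableSet.const _).union
    (MeasurableSet.iUnion fun p => (MeasurableSet.const _).inter (measurableSet_prefixOf _))

instance : IsProbabilityMeasure fairCoin :=
  inferInstanceAs (IsProbabilityMeasure (Measure.infinitePi _))

theorem fairCoin_prefixOf_inter_shift (σ : Str) {A : Set Cantor} (hA : MeasurableSet A) :
    fairCoin ({X | PrefixOf σ X} ∩ (fun X i => X (i + σ.length)) ⁻¹' A) =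
      (2⁻¹ : ℝ≥0∞) ^ σ.length * fairCoin A := by
  have hbit (b : Bool) : (PMF.uniformOfFintype Bool).toMeasure {b} = 2⁻¹ := by simp
  rw [setOf_prefixOf_eq_pi, fairCoin,
    infinitePi_pi_inter_shift _ _ (fun i => measurableSet_singleton _) hA]
  simp only [hbit, Finset.prod_const, Finset.card_range]

/-- The sequence `σ ⌢ X`. For `σ = 1 ^ e 0`, the universal functional simulates `Φ_e` on `X` when
it is given this oracle. -/
def appendSeq (σ : Str) (X : Cantor) : Cantor := fun i => σ.getD i (X (i - σ.length))

theorem measurable_appendSeq (σ : Str) : Measurable (appendSeq σ) := by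
  refine measurable_pi_lambda _ fun i => ?_
  exact (measurable_of_countable fun b => σ.getD i b).comp (measurable_pi_apply (i - σ.length))

theorem PrefixOf.appendSeq (ρ : Str) {σ : Str} {X : Cantor} (h : PrefixOf σ X) :
    PrefixOf (ρ ++ σ) (appendSeq ρ X) := by
  rw [prefixOf_iff] at h ⊢
  intro i hi
  rw [DeepClasses.appendSeq, List.getElem_append]
  split_ifs with hρ
  · rw [List.getD_eq_getElem _ _ hρ]
  · rw [List.getD_eq_default _ _ (not_lt.1 hρ), h]

theorem PrefixOf.appendSeq_shift {σ : Str} {X : Cantor} (h : PrefixOf σ X) :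
    DeepClasses.appendSeq σ (fun i => X (i + σ.length)) = X := by
  funext i
  rw [DeepClasses.appendSeq]
  rcases lt_or_ge i σ.length with hi | hi
  · rw [List.getD_eq_getElem _ _ hi, prefixOf_iff.1 h]
  · rw [List.getD_eq_default _ _ hi, Nat.sub_add_cancel hi]

theorem two_pow_mul_inv_pow (c : ℕ) : (2 : ℝ≥0∞) ^ c * (2⁻¹ : ℝ≥0∞) ^ c = 1 := by
  rw [← mul_pow, ENNReal.mul_inv_cancel (by simp) (by simp), one_pow]

theorem fairCoin_preimage_appendSeq_le (σ : Str) {B : Set Cantor} (hB : MeasurableSet B) :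
    fairCoin (appendSeq σ ⁻¹' B) ≤ 2 ^ σ.length * fairCoin B := by
  have hA : MeasurableSet (appendSeq σ ⁻¹' B) := measurable_appendSeq σ hB
  calc fairCoin (appendSeq σ ⁻¹' B)
      = 2 ^ σ.length * ((2⁻¹ : ℝ≥0∞) ^ σ.length * fairCoin (appendSeq σ ⁻¹' B)) := by
        rw [← mul_assoc, two_pow_mul_inv_pow, one_mul]
    _ ≤ 2 ^ σ.length * fairCoin B := by
        rw [← fairCoin_prefixOf_inter_shift σ hA]
        gcongr
        rintro X ⟨hX, hXB⟩
        rwa [Set.mem_preimage, Set.mem_preimage, PrefixOf.appendSeq_shift hX] at hXB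

theorem exists_inducedSemimeasure_le_aprioriM {Φ : Set (Str × Str)} (hΦ : IsTuringFunctional Φ) :
    ∃ c : ℕ, ∀ τ, inducedSemimeasure Φ τ ≤ 2 ^ c * aprioriM τ := by
  obtain ⟨e, rfl⟩ := exists_functional_eq hΦ
  refine ⟨(List.replicate e true ++ [false]).length, fun τ => (measure_mono ?_).trans
    (fairCoin_preimage_appendSeq_le _ (measurableSet_outputs universalFunctional τ))⟩
  rintro X (h | ⟨σ, τ', hm, hσ, hτ⟩)
  · exact Or.inl h
  · exact Or.inr ⟨_, τ', ⟨e, σ, hm, by simp⟩, hσ.appendSeq _, hτ⟩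

theorem tsum_aprioriM {S : Set Str} {m : ℕ} (hS : ∀ σ ∈ S, σ.length = m) :
    ∑' σ : S, aprioriM σ = fairCoin (⋃ σ : S, {X | Outputs universalFunctional X σ}) := by
  refine (measure_iUnion ?_ fun σ => measurableSet_outputs _ _).symm
  intro σ τ hne
  refine Set.disjoint_left.2 fun X hσ hτ => hne (Subtype.ext ?_)
  exact (Outputs.comparable isTuringFunctional_universal.2 hσ hτ).eq_of_length
    ((hS _ σ.2).trans (hS _ τ.2).symm)

theorem exists_tsum_aprioriM_le {Φ : Set (Str × Str)} (hΦ : IsTuringFunctional Φ) :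
    ∃ c : ℕ, ∀ (S S' : Set Str) (m : ℕ), (∀ σ ∈ S, σ.length = m) →
      (∀ σ ∈ S, ∃ τ ∈ S', StringOutputs Φ σ τ) →
      ∑' σ : S, aprioriM σ ≤ 2 ^ c * ∑' τ : S', aprioriM τ := by
  obtain ⟨c, hc⟩ := exists_inducedSemimeasure_le_aprioriM (hΦ.comp isTuringFunctional_universal)
  refine ⟨c, fun S S' m hS h => ?_⟩
  rw [tsum_aprioriM hS, ← ENNReal.tsum_mul_left]
  calc fairCoin (⋃ σ : S, {X | Outputs universalFunctional X σ})
      ≤ fairCoin (⋃ τ : S', {X | Outputs (compFunctional Φ universalFunctional) X τ}) := by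
        refine measure_mono (Set.iUnion_subset fun σ X hX => ?_)
        obtain ⟨τ, hτ, hστ⟩ := h σ σ.2
        exact Set.mem_iUnion.2 ⟨⟨τ, hτ⟩, Outputs.comp hX hστ⟩
    _ ≤ ∑' τ : S', fairCoin {X | Outputs (compFunctional Φ universalFunctional) X τ} :=
        measure_iUnion_le _
    _ ≤ ∑' τ : S', 2 ^ c * aprioriM τ := ENNReal.tsum_le_tsum fun τ => hc τ

/-! ### Levels of the canonical tree -/

/-- The a priori probability `M(T_n)` of the `n`-th level of the canonical tree of `C`. -/
noncomputable def levelMass (C : Set Cantor) (n : ℕ) : ℝ≥0∞ :=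
  ∑' σ : level (canonicalTree C) n, aprioriM σ

theorem mem_level {C : Set Cantor} {σ : Str} {n : ℕ} :
    σ ∈ level (canonicalTree C) n ↔ ∃ X ∈ C, restr X n = σ := by
  constructor
  · rintro ⟨⟨X, hX, hp⟩, rfl⟩
    exact ⟨X, hX, hp⟩
  · rintro ⟨X, hX, rfl⟩
    exact ⟨⟨X, hX, prefixOf_restr X n⟩, length_restr X n⟩

theorem restr_mem_level {C : Set Cantor} {X : Cantor} (hX : X ∈ C) (n : ℕ) :
    restr X n ∈ level (canonicalTree C) n :=
  mem_level.2 ⟨X, hX, rfl⟩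

theorem levelMass_eq_fairCoin (C : Set Cantor) (n : ℕ) :
    levelMass C n =
      fairCoin (⋃ σ : level (canonicalTree C) n, {X | Outputs universalFunctional X σ}) :=
  tsum_aprioriM fun _ hσ => hσ.2

theorem levelMass_le_one (C : Set Cantor) (n : ℕ) : levelMass C n ≤ 1 :=
  (levelMass_eq_fairCoin C n).trans_le prob_le_one

theorem antitone_levelMass (C : Set Cantor) : Antitone (levelMass C) := by
  intro n m hnm
  rw [levelMass_eq_fairCoin, levelMass_eq_fairCoin]
  refine measure_mono (Set.iUnion_subset fun ⟨σ, hσ⟩ X hX => ?_)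
  obtain ⟨Y, hY, rfl⟩ := mem_level.1 hσ
  exact Set.mem_iUnion.2 ⟨⟨restr Y n, restr_mem_level hY n⟩,
    Outputs.of_prefix hX (restr_prefix Y hnm)⟩

theorem exists_isComputableOrder_apply_le {f : ℕ → ℕ} (hf : Computable f) :
    ∃ h, IsComputableOrder h ∧ ∀ n, h n = 0 ∨ f (h n) ≤ n := by
  have hle : Computable₂ fun n k => decide (f k ≤ n) :=
    Primrec.nat_le.decide.to_comp.comp (hf.comp Computable.snd) Computable.fst
  refine ⟨fun n => n.findGreatest fun k => f k ≤ n,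
    ⟨computable_findGreatest Computable.id hle, fun m n hmn => ?_, fun k => ⟨max k (f k), ?_⟩⟩,
    fun n => or_iff_not_imp_left.2 (Nat.findGreatest_of_ne_zero (P := fun k => f k ≤ n) rfl)⟩
  · exact Nat.findGreatest_mono (fun k hk => le_trans hk hmn) hmn
  · exact Nat.le_findGreatest (le_max_left _ _) (le_max_right _ _)

theorem isDeep_iff {C : Set Cantor} :
    IsDeep C ↔ ∃ f : ℕ → ℕ, Computable f ∧ ∀ k, levelMass C (f k) ≤ (2⁻¹ : ℝ≥0∞) ^ k := by
  constructor
  · rintro ⟨h, ⟨hcomp, -, hunbounded⟩, hle⟩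
    obtain ⟨f, hf, hfk⟩ := exists_computable_choice (p := fun k n => k ≤ h n)
      (ComputablePred.to_re ⟨fun x => inferInstanceAs (Decidable (x.1 ≤ h x.2)),
        Primrec.nat_le.decide.to_comp.comp Computable.fst (hcomp.comp Computable.snd)⟩) hunbounded
    exact ⟨f, hf, fun k => (hle (f k)).trans (pow_le_pow_right_of_le_one' (by simp) (hfk k))⟩
  · rintro ⟨f, hf, hle⟩
    obtain ⟨h, hh, hfh⟩ := exists_isComputableOrder_apply_le hf
    refine ⟨h, hh, fun n => ?_⟩
    rcases hfh n with h0 | hn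
    · rw [h0, pow_zero]
      exact levelMass_le_one C n
    · exact (antitone_levelMass C hn).trans (hle (h n))

/-! ### Effective compactness -/

/-- The list of all strings of length `n`, which makes bounded quantification over strings
effective. -/
def stringsOfLength (n : ℕ) : List Str :=
  n.rec [[]] fun _ L => L.flatMap fun σ => [false :: σ, true :: σ]

theorem mem_stringsOfLength {n : ℕ} {σ : Str} : σ ∈ stringsOfLength n ↔ σ.length = n := by
  induction n generalizing σ with
  | zero => simp [stringsOfLength]
  | succ n ih =>
    change σ ∈ (stringsOfLength n).flatMap _ ↔ _
    rcases σ with _ | ⟨_ | _, σ⟩ <;> simp [ih]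

theorem primrec_stringsOfLength : Primrec stringsOfLength := by
  refine Primrec.nat_rec₁ _ (Primrec.list_flatMap Primrec.snd ?_)
  have hcons (b : Bool) : Primrec fun x : (ℕ × List Str) × Str => b :: x.2 :=
    Primrec.list_cons.comp (Primrec.const b) Primrec.snd
  exact Primrec.list_cons.comp (hcons false)
    (Primrec.list_cons.comp (hcons true) (Primrec.const []))

theorem restr_getD (σ : Str) : restr (fun i => σ.getD i false) σ.length = σ :=
  prefixOf_iff.2 fun i hi => by rw [List.getD_eq_getElem _ _ hi]

theorem isOpen_setOf_restr (P : Str → Prop) (n : ℕ) : IsOpen {X | P (restr X n)} := by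
  have hrestr (X : Cantor) : restr X n = List.ofFn fun i : Fin n => X i :=
    List.ext_getElem (by simp [restr]) fun i _ _ => by simp [restr]
  have hcont : Continuous fun (X : Cantor) (i : Fin n) => X i := by fun_prop
  simp only [hrestr]
  exact (isOpen_discrete {v : Fin n → Bool | P (List.ofFn v)}).preimage hcont

theorem exists_length_of_forall_restr {P : Str → Prop} (hP : ∀ σ τ, σ <+: τ → P σ → P τ)
    (h : ∀ X, ∃ n, P (restr X n)) : ∃ m, ∀ σ : Str, σ.length = m → P σ := by
  obtain ⟨m, hm⟩ := isCompact_univ.elim_directed_cover (fun n => {X : Cantor | P (restr X n)})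
    (isOpen_setOf_restr P) (fun X _ => Set.mem_iUnion.2 (h X))
    (Monotone.directed_le fun _ _ hnm X hX => hP _ _ (restr_prefix X hnm) hX)
  refine ⟨m, ?_⟩
  rintro σ rfl
  exact restr_getD σ ▸ hm (Set.mem_univ fun i => σ.getD i false)

theorem exists_computable_bar {α : Type} [Primcodable α] {P : α → Str → Prop}
    (hre : REPred fun x : α × Str => P x.1 x.2)
    (hP : ∀ a σ τ, σ <+: τ → P a σ → P a τ) {D : Set Cantor} (hD : IsPi01 D)
    (h : ∀ a, ∀ X ∈ D, ∃ n, P a (restr X n)) :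
    ∃ u : α → ℕ, Computable u ∧ ∀ a, ∀ X ∈ D, P a (restr X (u a)) := by
  obtain ⟨S, hS, rfl⟩ := hD
  -- Strings seen to leave the class are added, so that all of Cantor space is covered.
  let Q (a : α) (σ : Str) : Prop := (∃ ρ, ρ ∈ S ∧ ρ <+: σ) ∨ P a σ
  have hQre : REPred fun x : α × Str => Q x.1 x.2 :=
    re_or (re_exists (p := fun (x : α × Str) ρ => ρ ∈ S ∧ ρ <+: x.2)
      (re_and (re_comp hS Computable.snd)
        (re_of_primrec (primrec_prefix Primrec.snd (Primrec.snd.comp Primrec.fst))))) hre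
  have hQ (a : α) (σ τ : Str) (hστ : σ <+: τ) : Q a σ → Q a τ :=
    Or.imp (fun ⟨ρ, hρ, hρσ⟩ => ⟨ρ, hρ, hρσ.trans hστ⟩) (hP a σ τ hστ)
  have hcover (a : α) (X : Cantor) : ∃ n, Q a (restr X n) := by
    by_cases hX : X ∈ openOf S
    · obtain ⟨ρ, hρ, hρX⟩ := hX
      exact ⟨ρ.length, Or.inl ⟨ρ, hρ, hρX.symm ▸ List.prefix_rfl⟩⟩
    · exact (h a X hX).imp fun n => Or.inr
  have hQlevel : REPred fun x : α × ℕ => ∀ σ ∈ stringsOfLength x.2, Q x.1 σ :=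
    re_forall_mem_list (p := fun (x : α × ℕ) σ => Q x.1 σ)
      (re_comp hQre (f := fun y : (α × ℕ) × Str => (y.1.1, y.2))
        ((Computable.fst.comp Computable.fst).pair Computable.snd))
      (primrec_stringsOfLength.comp Primrec.snd)
  obtain ⟨u, hu, hQu⟩ := exists_computable_choice hQlevel fun a =>
    (exists_length_of_forall_restr (hQ a) (hcover a)).imp fun m hm σ hσ =>
      hm σ (mem_stringsOfLength.1 hσ)
  refine ⟨u, hu, fun a X hX => ?_⟩
  refine (hQu a _ (mem_stringsOfLength.2 (length_restr X (u a)))).resolve_left ?_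
  rintro ⟨ρ, hρ, hρX⟩
  exact hX ⟨ρ, hρ, (prefixOf_restr X (u a)).of_prefix hρX⟩

theorem exists_computable_use {C D : Set Cantor} (hD : IsPi01 D) {Φ : Set (Str × Str)}
    (hΦ : IsTuringFunctional Φ) (hmap : ∀ X ∈ D, ∃ Y ∈ C, MapsTo Φ X Y) :
    ∃ u : ℕ → ℕ, Computable u ∧
      ∀ n, ∀ X ∈ D, ∃ Y ∈ C, StringOutputs Φ (restr X (u n)) (restr Y n) := by
  have hre : REPred fun x : ℕ × Str => ∃ τ : Str, τ.length = x.1 ∧ StringOutputs Φ x.2 τ :=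
    re_exists (p := fun (x : ℕ × Str) (τ : Str) => τ.length = x.1 ∧ StringOutputs Φ x.2 τ)
      (re_and
        (re_of_primrec (Primrec.eq.comp (Primrec.list_length.comp Primrec.snd)
          (Primrec.fst.comp Primrec.fst)))
        (re_comp (re_stringOutputs hΦ.1) (f := fun y : (ℕ × Str) × Str => (y.1.2, y.2))
          ((Computable.snd.comp Computable.fst).pair Computable.snd)))
  obtain ⟨u, hu, hbar⟩ := exists_computable_bar
    (P := fun n σ => ∃ τ : Str, τ.length = n ∧ StringOutputs Φ σ τ) hre
    (fun n σ σ' hσ ⟨τ, hτ, hστ⟩ => ⟨τ, hτ, hστ.extend hσ⟩) hD fun n X hX => by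
      obtain ⟨Y, -, hXY⟩ := hmap X hX
      exact (outputs_iff_exists_restr.1 (hXY n)).imp fun k hk => ⟨_, length_restr Y n, hk⟩
  refine ⟨u, hu, fun n X hX => ?_⟩
  obtain ⟨Y, hY, hXY⟩ := hmap X hX
  obtain ⟨τ, hτ, hout⟩ := hbar n X hX
  have hτY : τ = restr Y n :=
    ((outputs_iff_exists_restr.2 ⟨_, hout⟩).comparable hΦ.2 (hXY n)).eq_of_length
      (hτ.trans (length_restr Y n).symm)
  exact ⟨Y, hY, hτY ▸ hout⟩

/-! ### The filter of deep degrees -/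

theorem two_pow_mul_inv_pow_add (c k : ℕ) :
    (2 : ℝ≥0∞) ^ c * (2⁻¹ : ℝ≥0∞) ^ (c + k) = (2⁻¹ : ℝ≥0∞) ^ k := by
  rw [pow_add, ← mul_assoc, two_pow_mul_inv_pow, one_mul]

theorem computable_const_add (c : ℕ) : Computable fun k => c + k :=
  (Primrec.nat_add.comp (Primrec.const c) Primrec.id).to_comp

theorem IsDeep.of_medvedevLE {C D : Set Cantor} (hC : IsDeep C) (hD : IsPi01 D)
    (h : MedvedevLE C D) : IsDeep D := by
  obtain ⟨Φ, hΦ, hmap⟩ := h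
  obtain ⟨u, hu, huse⟩ := exists_computable_use hD hΦ hmap
  obtain ⟨c, hc⟩ := exists_tsum_aprioriM_le hΦ
  obtain ⟨f, hf, hfk⟩ := isDeep_iff.1 hC
  refine isDeep_iff.2 ⟨fun k => u (f (c + k)), hu.comp (hf.comp (computable_const_add c)),
    fun k => ?_⟩
  calc levelMass D (u (f (c + k)))
      ≤ 2 ^ c * levelMass C (f (c + k)) := by
        refine hc _ _ _ (fun σ hσ => hσ.2) fun σ hσ => ?_
        obtain ⟨X, hX, rfl⟩ := mem_level.1 hσ
        obtain ⟨Y, hY, hout⟩ := huse (f (c + k)) X hX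
        exact ⟨_, restr_mem_level hY _, hout⟩
    _ ≤ 2 ^ c * (2⁻¹ : ℝ≥0∞) ^ (c + k) := by gcongr; exact hfk _
    _ = (2⁻¹ : ℝ≥0∞) ^ k := two_pow_mul_inv_pow_add c k

theorem isTuringFunctional_tail : IsTuringFunctional {p | p.2 = p.1.tail} := by
  refine ⟨re_of_primrec (Primrec.eq.comp Primrec.snd (Primrec.list_tail.comp Primrec.fst)), ?_⟩
  rintro σ τ _ τ' (hτ : τ = σ.tail) (hτ' : τ' = _) ⟨ρ, rfl⟩
  rw [hτ, hτ']
  cases σ with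
  | nil => exact Or.inl List.nil_prefix
  | cons b σ => exact Or.inl (List.prefix_append σ ρ)

theorem exists_levelMass_infClass_le : ∃ c : ℕ, ∀ (C D : Set Cantor) (n : ℕ),
    levelMass (infClass C D) (n + 1) ≤ 2 ^ c * (levelMass C n + levelMass D n) := by
  obtain ⟨c, hc⟩ := exists_tsum_aprioriM_le isTuringFunctional_tail
  refine ⟨c, fun C D n => ?_⟩
  calc levelMass (infClass C D) (n + 1)
      ≤ 2 ^ c * ∑' τ : (level (canonicalTree C) n ∪ level (canonicalTree D) n : Set Str),
          aprioriM τ := by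
        refine hc _ _ (n + 1) (fun σ hσ => hσ.2) fun σ hσ => ?_
        obtain ⟨_, ⟨Y, hY, rfl⟩ | ⟨Y, hY, rfl⟩, rfl⟩ := mem_level.1 hσ <;> rw [restr_consSeq]
        · exact ⟨restr Y n, Or.inl (restr_mem_level hY n), .of_mem rfl⟩
        · exact ⟨restr Y n, Or.inr (restr_mem_level hY n), .of_mem rfl⟩
    _ ≤ 2 ^ c * (levelMass C n + levelMass D n) := by
        gcongr
        exact ENNReal.tsum_union_le aprioriM _ _

theorem IsDeep.infClass {C D : Set Cantor} (hC : IsDeep C) (hD : IsDeep D) :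
    IsDeep (infClass C D) := by
  obtain ⟨c, hc⟩ := exists_levelMass_infClass_le
  obtain ⟨f, hf, hfk⟩ := isDeep_iff.1 hC
  obtain ⟨g, hg, hgk⟩ := isDeep_iff.1 hD
  have hadd : Computable fun k => c + (k + 1) := (computable_const_add c).comp Computable.succ
  let n (k : ℕ) : ℕ := max (f (c + (k + 1))) (g (c + (k + 1)))
  have hn : Computable n := Primrec.nat_max.to_comp.comp (hf.comp hadd) (hg.comp hadd)
  refine isDeep_iff.2 ⟨fun k => n k + 1, Computable.succ.comp hn, fun k => ?_⟩
  calc levelMass (DeepClasses.infClass C D) (n k + 1)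
      ≤ 2 ^ c * (levelMass C (n k) + levelMass D (n k)) := hc C D (n k)
    _ ≤ 2 ^ c * ((2⁻¹ : ℝ≥0∞) ^ (c + (k + 1)) + (2⁻¹ : ℝ≥0∞) ^ (c + (k + 1))) := by
        gcongr
        · exact (antitone_levelMass C (le_max_left _ _)).trans (hfk _)
        · exact (antitone_levelMass D (le_max_right _ _)).trans (hgk _)
    _ = (2⁻¹ : ℝ≥0∞) ^ k := by
        rw [mul_add, two_pow_mul_inv_pow_add, pow_succ, ← mul_add, ENNReal.inv_two_add_inv_two,
          mul_one]

theorem isLatticeFilter_deepDegrees : IsLatticeFilter deepDegrees := by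
  constructor
  · rintro _ y ⟨C, hC, rfl⟩ hle
    obtain ⟨D, rfl⟩ : ∃ D, degree D = y := Quotient.exists_rep y
    exact ⟨D, hC.of_medvedevLE D.isPi01 hle, rfl⟩
  · rintro _ _ ⟨C, hC, rfl⟩ ⟨D, hD, rfl⟩
    exact ⟨C.inf D, hC.infClass hD, rfl⟩

end DeepClasses

theorem mainTheorem4_general :
    (∀ C D : Set DeepClasses.Cantor, DeepClasses.IsPi01 D → DeepClasses.MedvedevLE C D →
      DeepClasses.IsDeep C → DeepClasses.IsDeep D) ∧
    (∀ C D : Set DeepClasses.Cantor, DeepClasses.IsDeep C → DeepClasses.IsDeep D →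
      DeepClasses.IsDeep (DeepClasses.infClass C D)) ∧
    DeepClasses.IsLatticeFilter DeepClasses.deepDegrees :=
  ⟨fun _ _ hD hle hC => hC.of_medvedevLE hD hle, fun _ _ hC hD => hC.infClass hD,
    DeepClasses.isLatticeFilter_deepDegrees⟩

theorem mainTheorem4 :
    (∀ C D : DeepClasses.Pi01Class, C ≤ D →
      DeepClasses.IsDeep C.carrier → DeepClasses.IsDeep D.carrier) ∧
    (∀ C D : DeepClasses.Pi01Class, DeepClasses.IsDeep C.carrier → DeepClasses.IsDeep D.carrier →
      DeepClasses.IsDeep (DeepClasses.infClass C.carrier D.carrier)) ∧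
    DeepClasses.IsLatticeFilter DeepClasses.deepDegrees :=
  ⟨fun C D hle => mainTheorem4_general.1 C.carrier D.carrier D.isPi01 hle,
    fun C D => mainTheorem4_general.2.1 C.carrier D.carrier, mainTheorem4_general.2.2⟩
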